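/- Let $d\ge 1$ and $0<\alpha<2$. For $t>0$ and $x\in\mathbb R^d$ let $$p_t(x)=(2\pi)^{-d}\int_{\mathbb R^d}e^{i\langle x,u\rangle}e^{-t|u|^\alpha}\,du ,$$ and put $p(s,x,t,y)=p_{t-s}(y-x)$ if $s<t$, and $p(s,x,t,y)=0$ if $s\ge t$. Let $\Delta^{\alpha/2}$ be the fractional Laplacian, i.e. the Fourier multiplier with symbol $-|u|^\alpha$. Let $j:\mathbb R^d\times\mathbb R^d\to[0,\infty)$ be Borel measurable, and suppose that there are $\eta\in[0,1)$ and $c\in[0,\infty)$ such that for all $s<t$ and $x,y\in\mathbb R^d$, $$\int_s^t\!du\int_{\mathbb R^d}\!dz\int_{\mathbb R^d}\!dw\; p(s,x,u,z)\,j(z,w)\,p(u,w,t,y)\le[\eta+c(t-s)]\,p(s,x,t,y).$$ Let $p_0=p$, $$p_n(s,x,t,y)=\int_s^t\!\int_{\mathbb R^d}p_{n-1}(s,x,u,z)\int_{\mathbb R^d}j(z,w)\,p(u,w,t,y)\,dw\,dz\,du\qquad(n\ge 1),$$ and $\tilde p=\sum_{n=0}^\infty p_n$. Then $\tilde p$ is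 finite everywhere, and it is the fundamental solution of $\partial_t+\Delta^{\alpha/2}+J$, where $(J\phi)(t,y)=\int_{\mathbb R^d} j(y,w)\phi(t,w)\,dw$, in the following sense: for every smooth compactly supported $\phi:\mathbb R\times\mathbb R^d\to\mathbb R$, the integral defining $(J\phi)(t,y)$ converges absolutely for almost every $(t,y)$, and for all $s\in\mathbb R$ and $x\in\mathbb R^d$ the function $(t,y)\mapsto\tilde p(s,x,t,y)\,[\partial_t+\Delta_y^{\alpha/2}+J]\phi(t,y)$ is integrable on $\mathbb R\times\mathbb R^d$ and $$\int_{\mathbb R}\int_{\mathbb R^d}\tilde p(s,x,t,y)\,[\partial_t+\Delta_y^{\alpha/2}+J]\phi(t,y)\,dy\,dt=-\phi(s,x).$$ -/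

import Mathlib

open MeasureTheory Set
open scoped ENNReal FourierTransform ContDiff

namespace NonlocalPerturbation

noncomputable section

/-- The state space `ℝᵈ` with its Euclidean norm and Lebesgue measure. -/
abbrev Space (d : ℕ) : Type := EuclideanSpace ℝ (Fin d)

/-- The isotropic `α`-stable density
`p_t(x) = (2π)^{-d} ∫ e^{i⟨x,u⟩} e^{-t|u|^α} du`, for `t > 0`.
(The integral is a real number, since `u ↦ e^{-t|u|^α}` is even.) -/
def stableDensity (d : ℕ) (α t : ℝ) (x : Space d) : ℝ :=
  ((2 * Real.pi) ^ d)⁻¹ *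
    (∫ u : Space d, Complex.exp (Complex.I * (inner ℝ x u : ℝ)) *
      (Real.exp (-t * ‖u‖ ^ α) : ℝ)).re

/-- The transition density `p(s,x,t,y) = p_{t-s}(y-x)` for `s < t`.
As a forward kernel density it vanishes for `t ≤ s`. -/
def stableTransition (d : ℕ) (α s : ℝ) (x : Space d) (t : ℝ) (y : Space d) : ℝ :=
  if s < t then stableDensity d α (t - s) (y - x) else 0

/-- The fractional Laplacian `Δ^{α/2} = -(-Δ)^{α/2}` of a real function on `ℝᵈ`, as the Fourier
multiplier with symbol `-|u|^α`. With the normalisation `e^{-2πi⟨x,ξ⟩}` of the Fourier transform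
used here, the frequency is `u = 2πξ`. -/
def fracLaplacian (d : ℕ) (α : ℝ) (f : Space d → ℝ) (x : Space d) : ℝ :=
  (𝓕⁻ (fun ξ : Space d =>
    ((-(2 * Real.pi * ‖ξ‖) ^ α : ℝ) : ℂ) * 𝓕 (fun y : Space d => (f y : ℂ)) ξ) x).re

/-- The terms `κ_n` of the perturbation series of a forward kernel density `κ` by the
instantaneous jump kernel `J(s,x,dt dy) = j(x,y) δ_s(dt) dy`:
`κ_0 = κ`, and
`κ_{n+1}(s,x,t,y) = ∫_s^t ∫ κ_n(s,x,u,z) ∫ j(z,w) κ(u,w,t,y) dw dz du`. -/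
def perturbTerm {d : ℕ} (κ : ℝ → Space d → ℝ → Space d → ℝ≥0∞)
    (j : Space d → Space d → ℝ≥0∞) :
    ℕ → ℝ → Space d → ℝ → Space d → ℝ≥0∞
  | 0 => κ
  | n + 1 => fun s x t y =>
      ∫⁻ u in Ioo s t, ∫⁻ z, perturbTerm κ j n s x u z * ∫⁻ w, j z w * κ u w t y

/-- The perturbation `∑ₙ κ_n` of `κ` by `J(s,x,dt dy) = j(x,y) δ_s(dt) dy`. -/
def perturbation {d : ℕ} (κ : ℝ → Space d → ℝ → Space d → ℝ≥0∞)
    (j : Space d → Space d → ℝ≥0∞) (s : ℝ) (x : Space d) (t : ℝ) (y : Space d) : ℝ≥0∞ :=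
  ∑' n, perturbTerm κ j n s x t y

/-- The perturbation `p̃` of the stable transition density `p` by
`J(s,x,dt dy) = j(x,y) δ_s(dt) dy`, a priori with values in `[0,∞]`. -/
def perturbedStable (d : ℕ) (α : ℝ) (j : Space d → Space d → ℝ)
    (s : ℝ) (x : Space d) (t : ℝ) (y : Space d) : ℝ≥0∞ :=
  perturbation (fun s x t y => ENNReal.ofReal (stableTransition d α s x t y))
    (fun z w => ENNReal.ofReal (j z w)) s x t y

/-- The smallness condition on the first term of the perturbation series: for all `s < t`, `x`, `y`,
`∫_s^t du ∫ dz ∫ dw p(s,x,u,z) j(z,w) p(u,w,t,y) ≤ [η + c(t-s)] p(s,x,t,y)`. -/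
def SmallFirstTerm (d : ℕ) (α : ℝ) (j : Space d → Space d → ℝ) (η c : ℝ) : Prop :=
  ∀ (s t : ℝ) (x y : Space d), s < t →
    (∫⁻ u in Ioo s t, ∫⁻ z, ∫⁻ w,
      ENNReal.ofReal (stableTransition d α s x u z) * ENNReal.ofReal (j z w) *
        ENNReal.ofReal (stableTransition d α u w t y))
      ≤ ENNReal.ofReal ((η + c * (t - s)) * stableTransition d α s x t y)

/-- The operator `(Jφ)(t,y) = ∫ j(y,w) φ(t,w) dw`. -/
def jumpOp {d : ℕ} (j : Space d → Space d → ℝ) (φ : ℝ × Space d → ℝ)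
    (t : ℝ) (y : Space d) : ℝ :=
  ∫ w, j y w * φ (t, w)

/-- `[∂_t + Δ_y^{α/2} + J] φ(t,y)`. -/
def perturbedGenerator (d : ℕ) (α : ℝ) (j : Space d → Space d → ℝ) (φ : ℝ × Space d → ℝ)
    (t : ℝ) (y : Space d) : ℝ :=
  deriv (fun τ => φ (τ, y)) t + fracLaplacian d α (fun w => φ (t, w)) y + jumpOp j φ t y

end

end NonlocalPerturbation

/-! Write `P` for integration against the stable density `p`, `P̃` for integration against `p̃`, and
`g = (∂_t + Δ^{α/2})φ`. Formally the theorem is two identities: `P g = -φ`, and the perturbation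
equation `P̃ = P + P̃ J P`. Together they give `P̃ g = P g + P̃ J P g = -φ - P̃ J φ`. The work lies
in making every term finite.

Convergence of the series. The terms satisfy `κ_{n+1} ≤ (η + c(t-s)/(n+1)) κ_n`
(`seriesTerm_succ_le`). The factor `1/(n+1)` appears because the time lengths of successive pieces
of a path add up to `t-s` and are not each bounded by it. The ratios tend to `η < 1`, so `p̃ ≤ C p`
on bounded time spans (`exists_tsum_seriesTerm_le`). The perturbation equation itself
(`tsum_seriesTerm_eq`) is an identity in `[0,∞]`. Chapman–Kolmogorov for `p` is not used.

Free equation. On the Fourier side `P g = -φ` is the fundamental theorem of calculus for `t ↦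
φ̂(t,ξ) e^{-(t-s)|2πξ|^α}` (`integral_stableTransition_mul_freeGenerator`). Undoing the transform
requires `p_t ≥ 0` and `p_t` integrable. Positivity (`stableDensity_nonneg`) comes from writing
`|u|^α` through Laplace transforms in `|u|²`, so that `e^{-t|u|^α}` is a limit of positive mixtures
of Gaussians and constants.

Finiteness. As `g` vanishes for large times, `P̃|g| < ∞` follows from `p̃ ≤ C p`. The free equation
gives `|φ| ≤ P g⁺ + P g⁻`, and the perturbation equation gives `P̃ J P h ≤ P̃ h`, whence `P̃ J |φ| <
∞` (`jumpPotential_lt_top`). Since `p̃ ≥ p > 0` locally for a suitable starting point, `J|φ|` is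
finite almost everywhere (`ae_jumpInt_lt_top`). Positive and negative parts are kept apart in
`[0,∞]` until all of them are known to be finite. -/

namespace NonlocalPerturbation

/-! ### Perturbation series of a forward kernel: algebra of `K J L`, and convergence. -/

section Kernels

variable {d : ℕ}

/-- The action `h ↦ ∫ j(z,w) h(u,w) dw` of the jump kernel on nonnegative functions. -/
noncomputable def jumpInt (j : Space d → Space d → ℝ≥0∞) (h : ℝ × Space d → ℝ≥0∞)
    (r : ℝ × Space d) : ℝ≥0∞ :=
  ∫⁻ w, j r.2 w * h (r.1, w)

/-- The composition `K J L` of two space-time kernels with the jump kernel in between. -/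
noncomputable def compJump (j : Space d → Space d → ℝ≥0∞)
    (K L : ℝ × Space d → ℝ × Space d → ℝ≥0∞) (p q : ℝ × Space d) : ℝ≥0∞ :=
  ∫⁻ r, K p r * jumpInt j (fun r' => L r' q) r

/-- The terms of the perturbation series as functions of two space-time points. -/
noncomputable def seriesTerm (κ : ℝ → Space d → ℝ → Space d → ℝ≥0∞)
    (j : Space d → Space d → ℝ≥0∞) (n : ℕ) (p q : ℝ × Space d) : ℝ≥0∞ :=
  perturbTerm κ j n p.1 p.2 q.1 q.2

lemma jumpInt_mono (j : Space d → Space d → ℝ≥0∞) {h h' : ℝ × Space d → ℝ≥0∞}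
    (hh : ∀ r, h r ≤ h' r) (r : ℝ × Space d) : jumpInt j h r ≤ jumpInt j h' r :=
  lintegral_mono fun w => by gcongr; exact hh _

lemma measurable_jumpInt_param {β : Type*} [MeasurableSpace β] {j : Space d → Space d → ℝ≥0∞}
    (hj : Measurable (Function.uncurry j)) {L : ℝ × Space d → β → ℝ≥0∞}
    (hL : Measurable (Function.uncurry L)) :
    Measurable (fun p : (ℝ × Space d) × β => jumpInt j (fun r' => L r' p.2) p.1) := by
  unfold jumpInt
  refine Measurable.lintegral_prod_right'
    (f := fun a : ((ℝ × Space d) × β) × Space d => j a.1.1.2 a.2 * L (a.1.1.1, a.2) a.1.2) ?_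
  have h1 : Measurable (fun a : ((ℝ × Space d) × β) × Space d => (a.1.1.2, a.2)) := by fun_prop
  have h2 : Measurable (fun a : ((ℝ × Space d) × β) × Space d => ((a.1.1.1, a.2), a.1.2)) := by
    fun_prop
  exact (hj.comp h1).mul (hL.comp h2)

lemma measurable_jumpInt {j : Space d → Space d → ℝ≥0∞}
    (hj : Measurable (Function.uncurry j)) {h : ℝ × Space d → ℝ≥0∞}
    (hh : Measurable h) : Measurable (jumpInt j h) := by
  have := measurable_jumpInt_param hj (β := Unit) (L := fun r _ => h r) (hh.comp measurable_fst)
  exact this.comp (measurable_id.prodMk (measurable_const : Measurable fun _ => ()))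

lemma measurable_compJump {j : Space d → Space d → ℝ≥0∞}
    (hj : Measurable (Function.uncurry j)) {K L : ℝ × Space d → ℝ × Space d → ℝ≥0∞}
    (hK : Measurable (Function.uncurry K)) (hL : Measurable (Function.uncurry L)) :
    Measurable (Function.uncurry (compJump j K L)) := by
  refine Measurable.lintegral_prod_right'
    (f := fun a : ((ℝ × Space d) × (ℝ × Space d)) × (ℝ × Space d) =>
      K a.1.1 a.2 * jumpInt j (fun r' => L r' a.1.2) a.2) ?_
  have h1 : Measurable (fun a : ((ℝ × Space d) × (ℝ × Space d)) × (ℝ × Space d) =>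
    (a.1.1, a.2)) := by fun_prop
  have h2 : Measurable (fun a : ((ℝ × Space d) × (ℝ × Space d)) × (ℝ × Space d) =>
    (a.2, a.1.2)) := by fun_prop
  exact (hK.comp h1).mul ((measurable_jumpInt_param hj hL).comp h2)

lemma jumpInt_lintegral {j : Space d → Space d → ℝ≥0∞}
    (hj : Measurable (Function.uncurry j)) {L : ℝ × Space d → ℝ × Space d → ℝ≥0∞}
    (hL : Measurable (Function.uncurry L)) {g : ℝ × Space d → ℝ≥0∞} (hg : Measurable g)
    (r : ℝ × Space d) :
    jumpInt j (fun r' => ∫⁻ q, L r' q * g q) r = ∫⁻ q, jumpInt j (fun r' => L r' q) r * g q := by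
  unfold jumpInt
  have hjr : Measurable (j r.2) := hj.comp measurable_prodMk_left
  have hLr : Measurable (fun a : Space d × (ℝ × Space d) => L (r.1, a.1) a.2) :=
    hL.comp (f := fun a : Space d × (ℝ × Space d) => ((r.1, a.1), a.2)) (by fun_prop)
  calc ∫⁻ w, j r.2 w * ∫⁻ q, L (r.1, w) q * g q
      = ∫⁻ w, ∫⁻ q, j r.2 w * L (r.1, w) q * g q := by
        refine lintegral_congr fun w => ?_
        rw [← lintegral_const_mul]
        · simp only [mul_assoc]
        · exact (hLr.comp measurable_prodMk_left).mul hg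
    _ = ∫⁻ q, ∫⁻ w, j r.2 w * L (r.1, w) q * g q := by
        refine lintegral_lintegral_swap (Measurable.aemeasurable ?_)
        exact ((hjr.comp measurable_fst).mul hLr).mul (hg.comp measurable_snd)
    _ = _ := by
        refine lintegral_congr fun q => ?_
        rw [lintegral_mul_const]
        exact hjr.mul (hLr.comp (measurable_id.prodMk measurable_const))

/-- Tonelli. It serves twice: with `g` the jump integral of a third kernel it is associativity, and
with `g` a source term it applies the perturbation equation to a function. -/
lemma lintegral_compJump_mul {j : Space d → Space d → ℝ≥0∞}
    (hj : Measurable (Function.uncurry j)) {K L : ℝ × Space d → ℝ × Space d → ℝ≥0∞}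
    (hK : Measurable (Function.uncurry K)) (hL : Measurable (Function.uncurry L))
    {g : ℝ × Space d → ℝ≥0∞} (hg : Measurable g) (p : ℝ × Space d) :
    ∫⁻ q, compJump j K L p q * g q
      = ∫⁻ r, K p r * jumpInt j (fun r' => ∫⁻ q, L r' q * g q) r := by
  have hKp : Measurable (K p) := hK.comp measurable_prodMk_left
  have hJ := measurable_jumpInt_param hj hL
  have hswap : Measurable (fun a : (ℝ × Space d) × (ℝ × Space d) => (a.2, a.1)) := by fun_prop
  calc ∫⁻ q, compJump j K L p q * g q
      = ∫⁻ q, ∫⁻ r, K p r * jumpInt j (fun r' => L r' q) r * g q := by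
        refine lintegral_congr fun q => ?_
        rw [compJump, lintegral_mul_const]
        exact hKp.mul (hJ.comp (measurable_id.prodMk measurable_const))
    _ = ∫⁻ r, ∫⁻ q, K p r * jumpInt j (fun r' => L r' q) r * g q := by
        refine lintegral_lintegral_swap (Measurable.aemeasurable ?_)
        exact ((hKp.comp measurable_snd).mul (hJ.comp hswap)).mul (hg.comp measurable_fst)
    _ = _ := by
        refine lintegral_congr fun r => ?_
        rw [jumpInt_lintegral hj hL hg, ← lintegral_const_mul]
        · simp only [mul_assoc]
        · exact (hJ.comp (measurable_const.prodMk measurable_id)).mul hg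

lemma compJump_assoc {j : Space d → Space d → ℝ≥0∞}
    (hj : Measurable (Function.uncurry j)) {K L M : ℝ × Space d → ℝ × Space d → ℝ≥0∞}
    (hK : Measurable (Function.uncurry K)) (hL : Measurable (Function.uncurry L))
    (hM : Measurable (Function.uncurry M)) (p q : ℝ × Space d) :
    compJump j (compJump j K L) M p q = compJump j K (compJump j L M) p q :=
  lintegral_compJump_mul hj hK hL
    (measurable_jumpInt hj (hM.comp (measurable_id.prodMk measurable_const))) p

variable {κ : ℝ → Space d → ℝ → Space d → ℝ≥0∞} {j : Space d → Space d → ℝ≥0∞}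

lemma seriesTerm_eq_zero (h0 : ∀ s x t y, t ≤ s → κ s x t y = 0) (n : ℕ) {p q : ℝ × Space d}
    (hpq : q.1 ≤ p.1) : seriesTerm κ j n p q = 0 := by
  cases n with
  | zero => exact h0 _ _ _ _ hpq
  | succ n => simp [seriesTerm, perturbTerm, Ioo_eq_empty (not_lt.mpr hpq)]

/-- The time integral over `(s,t)` extends to all times because one of the two factors vanishes
outside, so the recursion becomes a kernel composition. The two conclusions are intertwined: Tonelli
needs `κ_n` measurable, and measurability of `κ_{n+1}` is read off from the composed form. -/
lemma seriesTerm_succ_and_measurable (hj : Measurable (Function.uncurry j))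
    (h0 : ∀ s x t y, t ≤ s → κ s x t y = 0)
    (hκ : Measurable (Function.uncurry (seriesTerm κ j 0))) (n : ℕ) :
    Measurable (Function.uncurry (seriesTerm κ j n)) ∧
    seriesTerm κ j (n + 1) = compJump j (seriesTerm κ j n) (seriesTerm κ j 0) := by
  have key : ∀ n, Measurable (Function.uncurry (seriesTerm κ j n)) →
      seriesTerm κ j (n + 1) = compJump j (seriesTerm κ j n) (seriesTerm κ j 0) := by
    intro n hn
    funext p q
    unfold compJump
    rw [Measure.volume_eq_prod, lintegral_prod]
    · change ∫⁻ u in Ioo p.1 q.1, ∫⁻ z, seriesTerm κ j n p (u, z) *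
        jumpInt j (fun r' => seriesTerm κ j 0 r' q) (u, z) = _
      rw [← lintegral_indicator measurableSet_Ioo]
      refine lintegral_congr fun u => ?_
      by_cases hu : u ∈ Ioo p.1 q.1
      · rw [indicator_of_mem hu]
      · rw [indicator_of_notMem hu]
        symm
        rw [lintegral_eq_zero_iff']
        · refine Filter.Eventually.of_forall fun z => ?_
          rcases le_or_gt u p.1 with h | h
          · simp [seriesTerm_eq_zero h0 n (p := p) (q := (u, z)) h]
          · have h' : q.1 ≤ u := by
              by_contra hc
              exact hu ⟨h, not_le.mp hc⟩
            have : jumpInt j (fun r' => seriesTerm κ j 0 r' q) (u, z) = 0 := by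
              simp [jumpInt, seriesTerm_eq_zero (j := j) h0 0 (p := (u, _)) (q := q) h']
            simp [this]
        · refine Measurable.aemeasurable ?_
          refine Measurable.mul ?_ ?_
          · exact hn.comp (f := fun z : Space d => (p, (u, z))) (by fun_prop)
          · exact (measurable_jumpInt_param hj hκ).comp (f := fun z : Space d => ((u, z), q))
              (by fun_prop)
    · refine Measurable.aemeasurable ?_
      refine Measurable.mul ?_ ?_
      · exact hn.comp (f := fun z => (p, z)) (by fun_prop)
      · exact (measurable_jumpInt_param hj hκ).comp (f := fun z => (z, q)) (by fun_prop)
  have hn : Measurable (Function.uncurry (seriesTerm κ j n)) := by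
    induction n with
    | zero => exact hκ
    | succ n ih => rw [key n ih]; exact measurable_compJump hj ih hκ
  exact ⟨hn, key n hn⟩

/-- The bound `(n+1) κ_{n+1} ≤ ((n+1) η + c (t-s)) κ_n`. -/
lemma seriesTerm_succ_le (hj : Measurable (Function.uncurry j))
    (h0 : ∀ s x t y, t ≤ s → κ s x t y = 0)
    (hκ : Measurable (Function.uncurry (seriesTerm κ j 0))) {η c : ℝ} (hη : 0 ≤ η) (hc : 0 ≤ c)
    (h1 : ∀ p q, seriesTerm κ j 1 p q ≤ ENNReal.ofReal (η + c * (q.1 - p.1)) * seriesTerm κ j 0 p q)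
    (n : ℕ) (p q : ℝ × Space d) :
    ((n + 1 : ℕ) : ℝ≥0∞) * seriesTerm κ j (n + 1) p q ≤
      ENNReal.ofReal ((n + 1 : ℕ) * η + c * (q.1 - p.1)) * seriesTerm κ j n p q := by
  induction n generalizing p q with
  | zero => simpa using h1 p q
  | succ n ih =>
    have hmeas := fun m => (seriesTerm_succ_and_measurable hj h0 hκ m).1
    have hsucc := fun m => (seriesTerm_succ_and_measurable hj h0 hκ m).2
    set J : ℝ × Space d → ℝ≥0∞ := jumpInt j (fun r' => seriesTerm κ j 0 r' q) with hJ
    have hJm : Measurable J := measurable_jumpInt hj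
      ((hmeas 0).comp (f := fun z => (z, q)) (by fun_prop))
    have hTm : ∀ m, Measurable (seriesTerm κ j m p) := fun m =>
      (hmeas m).comp (f := fun z => (p, z)) (by fun_prop)
    have hTJ : ∀ m, Measurable (fun r => seriesTerm κ j m p r * J r) := fun m => (hTm m).mul hJm
    have e1 : seriesTerm κ j (n + 1 + 1) p q = ∫⁻ r, seriesTerm κ j (n + 1) p r * J r := by
      rw [hsucc (n + 1)]; rfl
    -- The same term is split in a second way, `κ_{n+2} = κ_n J κ_1`. The induction hypothesis will
    -- be applied to the first splitting, the one-step bound to this one.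
    have e2 : seriesTerm κ j (n + 1 + 1) p q
        = ∫⁻ r, seriesTerm κ j n p r * jumpInt j (fun r' => seriesTerm κ j 1 r' q) r := by
      rw [hsucc (n + 1), hsucc n, compJump_assoc hj (hmeas n) hκ hκ, ← hsucc 0]; rfl
    have i1 : ((n + 1 : ℕ) : ℝ≥0∞) * seriesTerm κ j (n + 1 + 1) p q ≤
        ∫⁻ r, ENNReal.ofReal ((n + 1 : ℕ) * η + c * (r.1 - p.1)) * (seriesTerm κ j n p r * J r) := by
      rw [e1, ← lintegral_const_mul _ (hTJ _)]
      refine lintegral_mono fun r => ?_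
      rw [← mul_assoc, ← mul_assoc]
      exact mul_le_mul_left (ih p r) _
    have i2 : seriesTerm κ j (n + 1 + 1) p q ≤
        ∫⁻ r, ENNReal.ofReal (η + c * (q.1 - r.1)) * (seriesTerm κ j n p r * J r) := by
      rw [e2]
      refine lintegral_mono fun r => ?_
      rw [mul_left_comm]
      gcongr
      rw [hJ, jumpInt, jumpInt, ← lintegral_const_mul]
      · refine lintegral_mono fun w => ?_
        rw [mul_left_comm]
        gcongr
        exact h1 (r.1, w) q
      · exact (hj.comp measurable_prodMk_left).mul
          ((hmeas 0).comp (f := fun w => ((r.1, w), q)) (by fun_prop))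
    have hw : Measurable (fun r : ℝ × Space d =>
        ENNReal.ofReal ((n + 1 : ℕ) * η + c * (r.1 - p.1)) * (seriesTerm κ j n p r * J r)) :=
      Measurable.mul (by fun_prop) (hTJ n)
    calc ((n + 1 + 1 : ℕ) : ℝ≥0∞) * seriesTerm κ j (n + 1 + 1) p q
        = ((n + 1 : ℕ) : ℝ≥0∞) * seriesTerm κ j (n + 1 + 1) p q
          + seriesTerm κ j (n + 1 + 1) p q := by
          rw [Nat.cast_succ (n + 1), add_mul, one_mul]
      _ ≤ _ := add_le_add i1 i2
      _ = ∫⁻ r, ENNReal.ofReal ((n + 1 + 1 : ℕ) * η + c * (q.1 - p.1)) *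
            (seriesTerm κ j n p r * J r) := by
          rw [← lintegral_add_left hw]
          -- At an intermediate time `r` the coefficients add up exactly: `(n+1)η + c(r-s)` plus `η
          -- + c(t-r)` is `(n+2)η + c(t-s)`. Outside `(s,t)`, where `ofReal` could truncate, the
          -- integrand is zero.
          refine lintegral_congr fun r => ?_
          rcases le_or_gt r.1 p.1 with h | h
          · simp [seriesTerm_eq_zero h0 n h]
          rcases le_or_gt q.1 r.1 with h' | h'
          · have hz : ∀ w, seriesTerm κ j 0 (r.1, w) q = 0 := fun w => seriesTerm_eq_zero h0 0 h'
            have : J r = 0 := by simp [hJ, jumpInt, hz]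
            simp [this]
          · rw [← add_mul, ← ENNReal.ofReal_add]
            · congr 2; push_cast; ring
            · have := sub_nonneg.mpr h.le; positivity
            · have := sub_nonneg.mpr h'.le; positivity
      _ = _ := by
          rw [lintegral_const_mul _ (hTJ _), hsucc n]; rfl

/-- Dividing the previous bound by `n+1` dominates the series by products of factors that converge
to a number below `1`; the ratio test applies. -/
lemma exists_tsum_seriesTerm_le (hj : Measurable (Function.uncurry j))
    (h0 : ∀ s x t y, t ≤ s → κ s x t y = 0)
    (hκ : Measurable (Function.uncurry (seriesTerm κ j 0))) {η c : ℝ} (hη : 0 ≤ η) (hη1 : η < 1)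
    (hc : 0 ≤ c)
    (h1 : ∀ p q, seriesTerm κ j 1 p q ≤ ENNReal.ofReal (η + c * (q.1 - p.1)) * seriesTerm κ j 0 p q)
    (T : ℝ) : ∃ C : ℝ≥0∞, C ≠ ⊤ ∧ ∀ p q : ℝ × Space d, q.1 - p.1 ≤ T →
      ∑' n, seriesTerm κ j n p q ≤ C * seriesTerm κ j 0 p q := by
  -- The slack `(1-η)/2` keeps every factor positive even when `η = c = 0`, as the ratio test
  -- requires, and still leaves the limit `(1+η)/2 < 1`. The maximum covers negative `T`.
  set b : ℕ → ℝ := fun n => η + c * max T 0 / ((n : ℝ) + 1) + (1 - η) / 2 with hb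
  have hbpos : ∀ n, 0 < b n := fun n => by
    have : 0 ≤ c * max T 0 / ((n : ℝ) + 1) := by positivity
    simp only [hb]; linarith
  set a : ℕ → ℝ := fun n => ∏ k ∈ Finset.range n, b k with ha
  have hapos : ∀ n, 0 < a n := fun n => Finset.prod_pos fun k _ => hbpos k
  have hsum : Summable a := by
    refine summable_of_ratio_test_tendsto_lt_one (l := η + 0 + (1 - η) / 2) (by linarith)
      (Filter.Eventually.of_forall fun n => (hapos n).ne') ?_
    have : (fun n => ‖a (n + 1)‖ / ‖a n‖) = b := by
      funext n
      rw [Real.norm_of_nonneg (hapos _).le, Real.norm_of_nonneg (hapos _).le,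
        div_eq_iff (hapos n).ne']
      simp only [ha, Finset.prod_range_succ]
      ring
    rw [this]
    refine Filter.Tendsto.add (Filter.Tendsto.add tendsto_const_nhds ?_) tendsto_const_nhds
    exact Filter.Tendsto.div_atTop tendsto_const_nhds
      (Filter.tendsto_atTop_add_const_right _ _ tendsto_natCast_atTop_atTop)
  refine ⟨∑' n, ENNReal.ofReal (a n), ?_, fun p q hpq => ?_⟩
  · rw [← ENNReal.ofReal_tsum_of_nonneg (fun n => (hapos n).le) hsum]
    exact ENNReal.ofReal_ne_top
  · rw [← ENNReal.tsum_mul_right]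
    refine ENNReal.tsum_le_tsum fun n => ?_
    induction n with
    | zero => simp [ha]
    | succ n ih =>
      have h := seriesTerm_succ_le hj h0 hκ hη hc h1 n p q
      have h2 : ((n + 1 : ℕ) : ℝ≥0∞) * seriesTerm κ j (n + 1) p q ≤
          ((n + 1 : ℕ) : ℝ≥0∞) * (ENNReal.ofReal (b n) * seriesTerm κ j n p q) := by
        refine h.trans ?_
        rw [← mul_assoc]
        gcongr
        rw [← ENNReal.ofReal_natCast, ← ENNReal.ofReal_mul (by positivity)]
        refine ENNReal.ofReal_le_ofReal ?_
        have e : ((n + 1 : ℕ) : ℝ) * b n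
            = (n + 1 : ℕ) * η + c * max T 0 + (n + 1 : ℕ) * ((1 - η) / 2) := by
          simp only [hb]; push_cast; field_simp
        rw [e]
        have e1 : c * (q.1 - p.1) ≤ c * max T 0 := by
          gcongr; exact hpq.trans (le_max_left _ _)
        have e2 : 0 ≤ ((n + 1 : ℕ) : ℝ) * ((1 - η) / 2) := by
          have : 0 ≤ 1 - η := by linarith
          positivity
        linarith
      have h3 : seriesTerm κ j (n + 1) p q ≤ ENNReal.ofReal (b n) * seriesTerm κ j n p q :=
        (ENNReal.mul_le_mul_iff_right (by simp) (by simp)).mp h2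
      refine h3.trans ?_
      have : a (n + 1) = b n * a n := by simp only [ha, Finset.prod_range_succ]; ring
      rw [this, ENNReal.ofReal_mul (hbpos n).le, mul_assoc]
      gcongr

/-- The perturbation equation: split off the term `n = 0` and sum the recursion. By monotone
convergence it holds without any convergence assumption. -/
lemma tsum_seriesTerm_eq (hj : Measurable (Function.uncurry j))
    (h0 : ∀ s x t y, t ≤ s → κ s x t y = 0)
    (hκ : Measurable (Function.uncurry (seriesTerm κ j 0))) (p q : ℝ × Space d) :
    ∑' n, seriesTerm κ j n p q = seriesTerm κ j 0 p q +
      compJump j (fun p q => ∑' n, seriesTerm κ j n p q) (seriesTerm κ j 0) p q := by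
  have hmeas := fun m => (seriesTerm_succ_and_measurable hj h0 hκ m).1
  have hsucc := fun m => (seriesTerm_succ_and_measurable hj h0 hκ m).2
  rw [tsum_eq_zero_add' ENNReal.summable]
  congr 1
  simp only [hsucc, compJump]
  rw [← lintegral_tsum]
  · simp only [ENNReal.tsum_mul_right]
  · intro n
    refine Measurable.aemeasurable (Measurable.mul ?_ ?_)
    · exact (hmeas n).comp (f := fun z => (p, z)) (by fun_prop)
    · exact measurable_jumpInt hj (hκ.comp (f := fun z => (z, q)) (by fun_prop))

end Kernels

/-! ### Radial functions that stay positive definite after Gaussian damping. -/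

section Subordination

open Filter Topology

/-- Bounded functions `f` on `[0,∞)` such that `v ↦ e^{-a|v|²} f(|v|²)` has a nonnegative Fourier
transform on `ℝᵈ` for all `a > 0`. -/
structure IsRadialPosDef (d : ℕ) (f : ℝ → ℝ) : Prop where
  measurable : Measurable f
  bounded : ∃ B, ∀ r, 0 ≤ r → |f r| ≤ B
  nonneg : ∀ a, 0 < a → ∀ x : Space d,
    0 ≤ ∫ v : Space d, Real.cos (inner ℝ x v) * (Real.exp (-a * ‖v‖ ^ 2) * f (‖v‖ ^ 2))

variable {d : ℕ} {f : ℝ → ℝ}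

lemma integrable_exp_neg_mul_sq_norm {a : ℝ} (ha : 0 < a) :
    Integrable (fun v : Space d => Real.exp (-a * ‖v‖ ^ 2)) := by
  have := GaussianFourier.integrable_cexp_neg_mul_sq_norm_add (V := Space d) (b := (a : ℂ))
    (by simpa using ha) 0 0
  refine (this.norm).congr (Eventually.of_forall fun v => ?_)
  simp [Complex.norm_exp, ← Complex.ofReal_pow]

lemma aestronglyMeasurable_radial (hf : Measurable f) (a : ℝ) (x : Space d) :
    AEStronglyMeasurable (fun v : Space d =>
      Real.cos (inner ℝ x v) * (Real.exp (-a * ‖v‖ ^ 2) * f (‖v‖ ^ 2))) := by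
  refine AEStronglyMeasurable.mul ?_ (AEStronglyMeasurable.mul ?_ ?_)
  · exact (by fun_prop : Continuous fun v : Space d =>
      Real.cos (inner ℝ x v)).aestronglyMeasurable
  · exact (by fun_prop : Continuous fun v : Space d =>
      Real.exp (-a * ‖v‖ ^ 2)).aestronglyMeasurable
  · exact (hf.comp (by fun_prop)).aestronglyMeasurable

lemma norm_radial_le {B : ℝ} (hB : ∀ r, 0 ≤ r → |f r| ≤ B) (a : ℝ) (x v : Space d) :
    ‖Real.cos (inner ℝ x v) * (Real.exp (-a * ‖v‖ ^ 2) * f (‖v‖ ^ 2))‖ ≤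
      Real.exp (-a * ‖v‖ ^ 2) * B := by
  rw [norm_mul, norm_mul, Real.norm_eq_abs, Real.norm_eq_abs, Real.norm_eq_abs, Real.abs_exp]
  calc _ ≤ 1 * (Real.exp (-a * ‖v‖ ^ 2) * B) := by
        gcongr
        · exact Real.abs_cos_le_one _
        · exact hB _ (by positivity)
    _ = _ := one_mul _

lemma IsRadialPosDef.integrable (hf : IsRadialPosDef d f) {a : ℝ} (ha : 0 < a) (x : Space d) :
    Integrable (fun v : Space d =>
      Real.cos (inner ℝ x v) * (Real.exp (-a * ‖v‖ ^ 2) * f (‖v‖ ^ 2))) := by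
  obtain ⟨B, hB⟩ := hf.bounded
  exact ((integrable_exp_neg_mul_sq_norm ha).mul_const B).mono'
    (aestronglyMeasurable_radial hf.measurable a x)
    (Eventually.of_forall fun v => norm_radial_le hB a x v)

/-- The Fourier transform of a Gaussian is a positive Gaussian. -/
lemma isRadialPosDef_one (d : ℕ) : IsRadialPosDef d (fun _ => 1) where
  measurable := measurable_const
  bounded := ⟨1, by simp⟩
  nonneg a ha x := by
    have hint := GaussianFourier.integrable_cexp_neg_mul_sq_norm_add (V := Space d) (b := (a : ℂ))
      (by simpa using ha) Complex.I x
    have h := GaussianFourier.integral_cexp_neg_mul_sq_norm_add (V := Space d) (b := (a : ℂ))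
      (by simpa using ha) Complex.I x
    have hre : ∫ v : Space d, Real.cos (inner ℝ x v) * (Real.exp (-a * ‖v‖ ^ 2) * 1)
        = (∫ v : Space d, Complex.exp (-(a : ℂ) * ↑‖v‖ ^ 2 + Complex.I * ↑(inner ℝ x v))).re := by
      have h2 := integral_re hint
      simp only [RCLike.re_to_complex] at h2
      rw [← h2]
      refine integral_congr_ae (Eventually.of_forall fun v => ?_)
      simp [Complex.exp_re, ← Complex.ofReal_pow, mul_comm]
    rw [hre, h]
    have e1 : ((Real.pi : ℂ) / a) ^ ((Module.finrank ℝ (Space d) : ℂ) / 2)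
        = ((Real.pi / a) ^ ((Module.finrank ℝ (Space d) : ℝ) / 2) : ℝ) := by
      rw [Complex.ofReal_cpow (by positivity)]
      push_cast
      rfl
    have e2 : Complex.exp (Complex.I ^ 2 * ↑‖x‖ ^ 2 / (4 * (a : ℂ)))
        = (Real.exp (-‖x‖ ^ 2 / (4 * a)) : ℝ) := by
      push_cast
      rw [Complex.I_sq]
      ring_nf
    rw [e1, e2, ← Complex.ofReal_mul, Complex.ofReal_re]
    positivity

lemma IsRadialPosDef.add {g : ℝ → ℝ} (hf : IsRadialPosDef d f) (hg : IsRadialPosDef d g) :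
    IsRadialPosDef d (fun r => f r + g r) where
  measurable := hf.measurable.add hg.measurable
  bounded := by
    obtain ⟨B, hB⟩ := hf.bounded
    obtain ⟨B', hB'⟩ := hg.bounded
    exact ⟨B + B', fun r hr => (abs_add_le _ _).trans (add_le_add (hB r hr) (hB' r hr))⟩
  nonneg a ha x := by
    simp only [mul_add]
    rw [integral_add (hf.integrable ha x) (hg.integrable ha x)]
    exact add_nonneg (hf.nonneg a ha x) (hg.nonneg a ha x)

lemma IsRadialPosDef.const_mul (hf : IsRadialPosDef d f) {c : ℝ} (hc : 0 ≤ c) :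
    IsRadialPosDef d (fun r => c * f r) where
  measurable := hf.measurable.const_mul c
  bounded := by
    obtain ⟨B, hB⟩ := hf.bounded
    refine ⟨c * B, fun r hr => ?_⟩
    rw [abs_mul, abs_of_nonneg hc]
    exact mul_le_mul_of_nonneg_left (hB r hr) hc
  nonneg a ha x := by
    have : ∀ v : Space d, Real.cos (inner ℝ x v) * (Real.exp (-a * ‖v‖ ^ 2) * (c * f (‖v‖ ^ 2)))
        = c * (Real.cos (inner ℝ x v) * (Real.exp (-a * ‖v‖ ^ 2) * f (‖v‖ ^ 2))) := fun v => by ring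
    simp only [this]
    rw [integral_const_mul]
    exact mul_nonneg hc (hf.nonneg a ha x)

lemma IsRadialPosDef.of_tendsto {F : ℕ → ℝ → ℝ} (hF : ∀ n, IsRadialPosDef d (F n)) {B : ℝ}
    (hB : ∀ n r, 0 ≤ r → |F n r| ≤ B) (hf : Measurable f)
    (hlim : ∀ r, 0 ≤ r → Tendsto (fun n => F n r) atTop (𝓝 (f r))) : IsRadialPosDef d f where
  measurable := hf
  bounded := ⟨B, fun r hr => le_of_tendsto (hlim r hr).abs (Eventually.of_forall fun n => hB n r hr)⟩
  nonneg a ha x := by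
    refine ge_of_tendsto (tendsto_integral_of_dominated_convergence
      (fun v : Space d => Real.exp (-a * ‖v‖ ^ 2) * B)
      (fun n => aestronglyMeasurable_radial (hF n).measurable a x)
      ((integrable_exp_neg_mul_sq_norm ha).mul_const B)
      (fun n => Eventually.of_forall fun v => norm_radial_le (hB n) a x v)
      (Eventually.of_forall fun v => ?_)) (Eventually.of_forall fun n => (hF n).nonneg a ha x)
    exact ((hlim _ (by positivity)).const_mul _).const_mul _

/-- A factor `e^{-s|v|²}` only shifts the damping parameter from `a` to `a + s`, and Fubini
superposes these with nonnegative weights `w s`. This is why positivity is demanded for every `a >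
0`. -/
lemma IsRadialPosDef.mul_laplace (hf : IsRadialPosDef d f) {w : ℝ → ℝ} {ε : ℝ} (hε : 0 ≤ ε)
    (hw0 : ∀ s, ε < s → 0 ≤ w s) (hw : IntegrableOn w (Ioi ε)) :
    IsRadialPosDef d (fun r => f r * ∫ s in Ioi ε, Real.exp (-s * r) * w s) where
  measurable := by
    refine hf.measurable.mul ?_
    refine StronglyMeasurable.measurable ?_
    -- The weight is only almost everywhere measurable; a strongly measurable version yields a
    -- genuinely measurable function of `r` with the same integrals.
    obtain ⟨w', hw', hww'⟩ := hw.aestronglyMeasurable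
    have : (fun r => ∫ s in Ioi ε, Real.exp (-s * r) * w s)
        = fun r => ∫ s in Ioi ε, Real.exp (-s * r) * w' s := by
      funext r
      refine integral_congr_ae ?_
      filter_upwards [hww'] with s hs
      rw [hs]
    rw [this]
    refine StronglyMeasurable.integral_prod_right ?_
    refine StronglyMeasurable.mul ?_ (hw'.comp_measurable measurable_snd)
    exact (by fun_prop : Continuous fun p : ℝ × ℝ => Real.exp (-p.2 * p.1)).stronglyMeasurable
  bounded := by
    obtain ⟨B, hB⟩ := hf.bounded
    refine ⟨B * ∫ s in Ioi ε, w s, fun r hr => ?_⟩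
    rw [abs_mul]
    have hB0 : 0 ≤ B := (abs_nonneg _).trans (hB r hr)
    refine mul_le_mul (hB r hr) ?_ (abs_nonneg _) hB0
    rw [← Real.norm_eq_abs]
    refine norm_integral_le_of_norm_le hw ?_
    filter_upwards [ae_restrict_mem measurableSet_Ioi] with s hs
    have hs' : 0 < s := hε.trans_lt hs
    rw [norm_mul, Real.norm_of_nonneg (hw0 s hs), Real.norm_of_nonneg (Real.exp_pos _).le]
    refine mul_le_of_le_one_left (hw0 s hs) (Real.exp_le_one_iff.mpr ?_)
    nlinarith
  nonneg a ha x := by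
    obtain ⟨B, hB⟩ := hf.bounded
    have hswap : ∫ v : Space d, ∫ s in Ioi ε, Real.cos (inner ℝ x v) *
          (Real.exp (-a * ‖v‖ ^ 2) * f (‖v‖ ^ 2)) * (Real.exp (-s * ‖v‖ ^ 2) * w s)
        = ∫ s in Ioi ε, ∫ v : Space d, Real.cos (inner ℝ x v) *
          (Real.exp (-a * ‖v‖ ^ 2) * f (‖v‖ ^ 2)) * (Real.exp (-s * ‖v‖ ^ 2) * w s) := by
      refine integral_integral_swap ?_
      have hdom := (hf.integrable ha x).norm.mul_prod hw.norm
      refine hdom.mono' ?_ ?_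
      · refine AEStronglyMeasurable.mul ?_ (AEStronglyMeasurable.mul ?_ ?_)
        · exact (hf.integrable ha x).aestronglyMeasurable.comp_fst
        · exact (by fun_prop : Continuous fun p : Space d × ℝ =>
            Real.exp (-p.2 * ‖p.1‖ ^ 2)).aestronglyMeasurable
        · exact hw.aestronglyMeasurable.comp_snd
      · have hsupp : ∀ᵐ p : Space d × ℝ ∂(volume.prod (volume.restrict (Ioi ε))), p.2 ∈ Ioi ε :=
          Measure.quasiMeasurePreserving_snd.ae (ae_restrict_mem measurableSet_Ioi)
        filter_upwards [hsupp] with p hp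
        have hs' : 0 < p.2 := hε.trans_lt hp
        simp only [Function.uncurry]
        rw [norm_mul, norm_mul (Real.exp _) (w _)]
        refine mul_le_mul_of_nonneg_left (mul_le_of_le_one_left (norm_nonneg _) ?_) (norm_nonneg _)
        rw [Real.norm_of_nonneg (Real.exp_pos _).le]
        refine Real.exp_le_one_iff.mpr ?_
        have := sq_nonneg ‖p.1‖
        nlinarith
    have hL : ∀ v : Space d, Real.cos (inner ℝ x v) * (Real.exp (-a * ‖v‖ ^ 2) *
        (f (‖v‖ ^ 2) * ∫ s in Ioi ε, Real.exp (-s * ‖v‖ ^ 2) * w s))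
        = ∫ s in Ioi ε, Real.cos (inner ℝ x v) *
          (Real.exp (-a * ‖v‖ ^ 2) * f (‖v‖ ^ 2)) * (Real.exp (-s * ‖v‖ ^ 2) * w s) := by
      intro v
      rw [integral_const_mul]
      ring
    simp only [hL]
    rw [hswap]
    refine setIntegral_nonneg measurableSet_Ioi fun s hs => ?_
    have hs' : 0 < s := hε.trans_lt hs
    have : ∀ v : Space d, Real.cos (inner ℝ x v) *
          (Real.exp (-a * ‖v‖ ^ 2) * f (‖v‖ ^ 2)) * (Real.exp (-s * ‖v‖ ^ 2) * w s)
        = Real.cos (inner ℝ x v) * (Real.exp (-(a + s) * ‖v‖ ^ 2) * f (‖v‖ ^ 2)) * w s := by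
      intro v
      rw [neg_add, add_mul, Real.exp_add]
      ring
    simp only [this]
    rw [integral_mul_const]
    exact mul_nonneg (hf.nonneg _ (by linarith) x) (hw0 s hs)

/-- Powers of the Laplace transform are handled by repeated multiplication, and the exponential
series has nonnegative coefficients. Its partial sums are uniformly bounded, so the limit passes. -/
lemma IsRadialPosDef.exp_laplace (d : ℕ) {w : ℝ → ℝ} {ε : ℝ} (hε : 0 ≤ ε)
    (hw0 : ∀ s, ε < s → 0 ≤ w s) (hw : IntegrableOn w (Ioi ε)) :
    IsRadialPosDef d (fun r => Real.exp (∫ s in Ioi ε, Real.exp (-s * r) * w s)) := by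
  set h : ℝ → ℝ := fun r => ∫ s in Ioi ε, Real.exp (-s * r) * w s with hh
  have hpow : ∀ k : ℕ, IsRadialPosDef d (fun r => h r ^ k) := by
    intro k
    induction k with
    | zero => simpa using isRadialPosDef_one d
    | succ k ih => simpa only [pow_succ] using ih.mul_laplace hε hw0 hw
  have hsum : ∀ n : ℕ, IsRadialPosDef d (fun r => ∑ k ∈ Finset.range n, h r ^ k / k.factorial) := by
    intro n
    induction n with
    | zero => simpa using (isRadialPosDef_one d).const_mul le_rfl
    | succ n ih =>
      simp only [Finset.sum_range_succ]
      refine ih.add ?_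
      simpa only [div_eq_inv_mul] using (hpow n).const_mul (c := ((n.factorial : ℝ))⁻¹) (by positivity)
  have h1 := hpow 1
  simp only [pow_one] at h1
  obtain ⟨B, hB⟩ := h1.bounded
  refine IsRadialPosDef.of_tendsto hsum (B := Real.exp B) (fun n r hr => ?_)
    (Real.measurable_exp.comp h1.measurable) (fun r hr => ?_)
  · calc |∑ k ∈ Finset.range n, h r ^ k / k.factorial|
        ≤ ∑ k ∈ Finset.range n, |h r| ^ k / k.factorial := by
          refine (Finset.abs_sum_le_sum_abs _ _).trans (Finset.sum_le_sum fun k _ => ?_)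
          rw [abs_div, abs_pow, Nat.abs_cast]
      _ ≤ Real.exp |h r| := Real.sum_le_exp_of_nonneg (abs_nonneg _) n
      _ ≤ Real.exp B := Real.exp_le_exp.mpr (hB r hr)
  · have := (NormedSpace.expSeries_div_hasSum_exp (𝔸 := ℝ) (h r)).tendsto_sum_nat
    rwa [← Real.exp_eq_exp_ℝ] at this

end Subordination

/-! ### The Lévy representation of `r^β` and positivity for `e^{-t r^β}`. -/

section LevyIntegral

open Filter Topology

/-- Near `0` the bound `1 - e^{-sr} ≤ sr` leaves `s^{-β}`, integrable as `β < 1`; near infinity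
`s^{-1-β}` is integrable as `β > 0`. -/
lemma integrableOn_one_sub_exp_mul_rpow {β : ℝ} (hβ : β ∈ Ioo (0 : ℝ) 1) {r : ℝ} (hr : 0 ≤ r) :
    IntegrableOn (fun s : ℝ => (1 - Real.exp (-s * r)) * s ^ (-1 - β)) (Ioi 0) := by
  obtain ⟨hβ0, hβ1⟩ := hβ
  have hmeas : Measurable (fun s : ℝ => (1 - Real.exp (-s * r)) * s ^ (-1 - β)) := by fun_prop
  rw [← Ioc_union_Ioi_eq_Ioi (zero_le_one (α := ℝ))]
  refine IntegrableOn.union ?_ ?_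
  · have h1 : IntegrableOn (fun s : ℝ => r * s ^ (-β)) (Ioc 0 1) := by
      have := (intervalIntegral.intervalIntegrable_rpow' (a := 0) (b := 1) (r := -β)
        (by linarith)).const_mul r
      rwa [intervalIntegrable_iff_integrableOn_Ioc_of_le zero_le_one] at this
    refine Integrable.mono' h1 hmeas.aestronglyMeasurable ?_
    filter_upwards [ae_restrict_mem measurableSet_Ioc] with s hs
    have hs0 : 0 < s := hs.1
    have hexp : Real.exp (-s * r) ≤ 1 := Real.exp_le_one_iff.mpr (by nlinarith)
    have hexp2 : 1 - Real.exp (-s * r) ≤ s * r := by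
      have := Real.add_one_le_exp (-s * r); linarith
    rw [Real.norm_of_nonneg (mul_nonneg (by linarith) (by positivity))]
    calc (1 - Real.exp (-s * r)) * s ^ (-1 - β) ≤ (s * r) * s ^ (-1 - β) := by gcongr
      _ = r * (s ^ (1 : ℝ) * s ^ (-1 - β)) := by rw [Real.rpow_one]; ring
      _ = r * s ^ (-β) := by rw [← Real.rpow_add hs0]; ring_nf
  · refine Integrable.mono' (integrableOn_Ioi_rpow_of_lt (a := -1 - β) (by linarith) one_pos)
      hmeas.aestronglyMeasurable ?_
    filter_upwards [ae_restrict_mem measurableSet_Ioi] with s hs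
    have hs0 : 0 < s := one_pos.trans hs
    have hexp : Real.exp (-s * r) ≤ 1 := Real.exp_le_one_iff.mpr (by nlinarith)
    rw [Real.norm_of_nonneg (mul_nonneg (by linarith) (by positivity))]
    refine mul_le_of_le_one_left (by positivity) ?_
    have := Real.exp_pos (-s * r)
    linarith

lemma integral_one_sub_exp_mul_rpow {β : ℝ} (hβ : β ∈ Ioo (0 : ℝ) 1) {r : ℝ} (hr : 0 ≤ r) :
    ∫ s in Ioi (0 : ℝ), (1 - Real.exp (-s * r)) * s ^ (-1 - β)
      = r ^ β * ∫ s in Ioi (0 : ℝ), (1 - Real.exp (-s)) * s ^ (-1 - β) := by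
  rcases hr.eq_or_lt with rfl | hr
  · simp [Real.zero_rpow hβ.1.ne']
  have h := integral_comp_mul_left_Ioi (fun s : ℝ => (1 - Real.exp (-s)) * s ^ (-1 - β)) 0 hr
  rw [mul_zero] at h
  have h2 : ∫ s in Ioi (0 : ℝ), (1 - Real.exp (-s * r)) * s ^ (-1 - β)
      = r ^ (1 + β) * ∫ s in Ioi (0 : ℝ), (1 - Real.exp (-(r * s))) * (r * s) ^ (-1 - β) := by
    rw [← integral_const_mul]
    refine setIntegral_congr_fun measurableSet_Ioi fun s hs => ?_
    have hs0 : (0 : ℝ) < s := hs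
    rw [Real.mul_rpow hr.le hs0.le]
    have : r ^ (1 + β) * r ^ (-1 - β) = 1 := by
      rw [← Real.rpow_add hr]; simp
    calc _ = (r ^ (1 + β) * r ^ (-1 - β)) * ((1 - Real.exp (-s * r)) * s ^ (-1 - β)) := by
          rw [this, one_mul]
      _ = _ := by rw [neg_mul, mul_comm s r]; ring
  rw [h2, h, smul_eq_mul, ← mul_assoc, Real.rpow_add hr, Real.rpow_one]
  field_simp

lemma integral_one_sub_exp_mul_rpow_pos {β : ℝ} (hβ : β ∈ Ioo (0 : ℝ) 1) :
    0 < ∫ s in Ioi (0 : ℝ), (1 - Real.exp (-s)) * s ^ (-1 - β) := by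
  have hint := integrableOn_one_sub_exp_mul_rpow hβ zero_le_one
  simp only [mul_one] at hint
  have hpos : ∀ s ∈ Ioi (0 : ℝ), 0 < (1 - Real.exp (-s)) * s ^ (-1 - β) := fun s hs => by
    have hs0 : (0 : ℝ) < s := hs
    have : Real.exp (-s) < 1 := by rw [Real.exp_lt_one_iff]; linarith
    exact mul_pos (by linarith) (by positivity)
  rw [setIntegral_pos_iff_support_of_nonneg_ae _ hint]
  · refine lt_of_lt_of_le (b := volume (Ioi (0 : ℝ))) (by simp) (measure_mono fun s hs => ?_)
    exact ⟨(hpos s hs).ne', hs⟩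
  · filter_upwards [ae_restrict_mem measurableSet_Ioi] with s hs using (hpos s hs).le

/-- Compound Poisson approximation. By scaling, `r^β` is a constant times `∫ (1 - e^{-sr}) s^{-1-β}
ds`. Restricted to `s > ε` the measure is finite, so the exponential factors into a positive
constant and the exponential of a Laplace transform; then `ε → 0`. -/
lemma isRadialPosDef_exp_neg_rpow (d : ℕ) {β t : ℝ} (hβ : β ∈ Ioo (0 : ℝ) 1) (ht : 0 ≤ t) :
    IsRadialPosDef d (fun r => Real.exp (-t * r ^ β)) := by
  set C := ∫ s in Ioi (0 : ℝ), (1 - Real.exp (-s)) * s ^ (-1 - β) with hC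
  have hCpos : 0 < C := integral_one_sub_exp_mul_rpow_pos hβ
  set τ := t / C with hτ
  have hτ0 : 0 ≤ τ := by positivity
  set ε : ℕ → ℝ := fun n => 1 / ((n : ℝ) + 1) with hε
  have hεpos : ∀ n, 0 < ε n := fun n => by positivity
  have hI : ∀ n, IntegrableOn (fun s : ℝ => τ * s ^ (-1 - β)) (Ioi (ε n)) := fun n =>
    (integrableOn_Ioi_rpow_of_lt (by linarith [hβ.1]) (hεpos n)).const_mul τ
  have hIr : ∀ n r, 0 ≤ r → IntegrableOn (fun s : ℝ => (1 - Real.exp (-s * r)) * s ^ (-1 - β))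
      (Ioi (ε n)) := fun n r hr =>
    (integrableOn_one_sub_exp_mul_rpow hβ hr).mono_set (Ioi_subset_Ioi (hεpos n).le)
  set F : ℕ → ℝ → ℝ := fun n r => Real.exp (-∫ s in Ioi (ε n), τ * s ^ (-1 - β)) *
    Real.exp (∫ s in Ioi (ε n), Real.exp (-s * r) * (τ * s ^ (-1 - β))) with hF
  have hFpos : ∀ n, IsRadialPosDef d (F n) := fun n =>
    (IsRadialPosDef.exp_laplace d (hεpos n).le (fun s hs => by
      have : 0 < s := (hεpos n).trans hs
      positivity) (hI n)).const_mul (Real.exp_pos _).le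
  have hFeq : ∀ n r, 0 ≤ r → F n r
      = Real.exp (-τ * ∫ s in Ioi (ε n), (1 - Real.exp (-s * r)) * s ^ (-1 - β)) := by
    intro n r hr
    simp only [hF]
    rw [← Real.exp_add, ← integral_const_mul]
    congr 1
    have h2 : IntegrableOn (fun s : ℝ => Real.exp (-s * r) * (τ * s ^ (-1 - β))) (Ioi (ε n)) := by
      refine ((hI n).sub ((hIr n r hr).const_mul τ)).congr (Eventually.of_forall fun s => ?_)
      simp only [Pi.sub_apply]
      ring
    rw [neg_add_eq_sub, ← integral_sub h2 (hI n)]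
    refine integral_congr_ae (Eventually.of_forall fun s => ?_)
    simp only
    ring
  refine IsRadialPosDef.of_tendsto hFpos (B := 1) (fun n r hr => ?_) (by fun_prop) (fun r hr => ?_)
  · rw [hFeq n r hr, Real.abs_exp, Real.exp_le_one_iff, neg_mul, neg_nonpos]
    refine mul_nonneg hτ0 (setIntegral_nonneg measurableSet_Ioi fun s hs => ?_)
    have hs0 : 0 < s := (hεpos n).trans hs
    have : Real.exp (-s * r) ≤ 1 := Real.exp_le_one_iff.mpr (by nlinarith)
    exact mul_nonneg (by linarith) (by positivity)
  · simp only [hFeq _ r hr]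
    have hU : ⋃ n, Ioi (ε n) = Ioi 0 := by
      ext s
      simp only [mem_iUnion, mem_Ioi]
      refine ⟨fun ⟨n, hn⟩ => (hεpos n).trans hn, fun hs => ?_⟩
      exact exists_nat_one_div_lt hs
    have hmono : Monotone (fun n => Ioi (ε n)) := fun m n hmn =>
      Ioi_subset_Ioi (Nat.one_div_le_one_div hmn)
    have hlim := tendsto_setIntegral_of_monotone (μ := volume)
      (f := fun s : ℝ => (1 - Real.exp (-s * r)) * s ^ (-1 - β))
      (fun n => measurableSet_Ioi) hmono (by rw [hU]; exact integrableOn_one_sub_exp_mul_rpow hβ hr)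
    rw [hU, integral_one_sub_exp_mul_rpow hβ hr, ← hC] at hlim
    have := (Real.continuous_exp.tendsto _).comp (hlim.const_mul (-τ))
    have e : -τ * (r ^ β * C) = -t * r ^ β := by
      rw [hτ]
      field_simp
    rwa [e] at this

end LevyIntegral

/-! ### The stable density: positivity, mass at most one, Fourier transform, continuity. -/

section StableDensity

open Filter Topology

variable {d : ℕ} {α t : ℝ}

lemma integrable_exp_neg_mul_norm_rpow (hd : 1 ≤ d) (hα : 0 < α) (ht : 0 < t) :
    Integrable (fun u : Space d => Real.exp (-t * ‖u‖ ^ α)) := by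
  have : Nonempty (Fin d) := ⟨⟨0, hd⟩⟩
  have : Nontrivial (Space d) := inferInstance
  refine (integrable_fun_norm_addHaar volume (f := fun r : ℝ => Real.exp (-t * r ^ α))).mpr ?_
  have h := integrableOn_rpow_mul_exp_neg_mul_rpow (p := α) (b := t)
    (s := ((Module.finrank ℝ (Space d) - 1 : ℕ) : ℝ))
    (by have : (0 : ℝ) ≤ ((Module.finrank ℝ (Space d) - 1 : ℕ) : ℝ) := Nat.cast_nonneg _
        linarith) hα ht
  simpa [Real.rpow_natCast] using h

/-- The characteristic function `ξ ↦ e^{-t|2πξ|^α}` of the stable law. -/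
noncomputable def stableChar (d : ℕ) (α t : ℝ) (ξ : Space d) : ℂ :=
  (Real.exp (-t * (2 * Real.pi * ‖ξ‖) ^ α) : ℝ)

lemma continuous_stableChar (hα : 0 < α) : Continuous (stableChar d α t) := by
  unfold stableChar
  have : Continuous fun ξ : Space d => (2 * Real.pi * ‖ξ‖) ^ α :=
    (by fun_prop : Continuous fun ξ : Space d => 2 * Real.pi * ‖ξ‖).rpow_const
      fun _ => Or.inr hα.le
  fun_prop

lemma integrable_stableChar (hd : 1 ≤ d) (hα : 0 < α) (ht : 0 < t) :
    Integrable (stableChar d α t) := by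
  have h := (integrable_exp_neg_mul_norm_rpow hd hα ht).comp_smul (R := 2 * Real.pi)
    (by positivity)
  refine h.ofReal.congr (Eventually.of_forall fun ξ => ?_)
  simp only [stableChar, norm_smul, Real.norm_of_nonneg Real.two_pi_pos.le]
  rfl

lemma norm_stableChar_le (ht : 0 ≤ t) (ξ : Space d) : ‖stableChar d α t ξ‖ ≤ 1 := by
  rw [stableChar, Complex.norm_real, Real.norm_of_nonneg (Real.exp_pos _).le, Real.exp_le_one_iff]
  have : 0 ≤ (2 * Real.pi * ‖ξ‖) ^ α := by positivity
  nlinarith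

lemma integrable_cexp_mul_exp_neg (hd : 1 ≤ d) (hα : 0 < α) (ht : 0 < t) (x : Space d) :
    Integrable (fun u : Space d => Complex.exp (Complex.I * (inner ℝ x u : ℝ)) *
      (Real.exp (-t * ‖u‖ ^ α) : ℝ)) := by
  refine (integrable_exp_neg_mul_norm_rpow hd hα ht).ofReal.bdd_mul (c := 1) ?_ ?_
  · exact (by fun_prop : Continuous fun u : Space d =>
      Complex.exp (Complex.I * (inner ℝ x u : ℝ))).aestronglyMeasurable
  · refine Eventually.of_forall fun u => ?_
    rw [mul_comm, Complex.norm_exp_ofReal_mul_I]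

lemma ofReal_stableDensity (x : Space d) :
    (stableDensity d α t x : ℂ) = 𝓕 (stableChar d α t) x := by
  set g : Space d → ℂ := fun u => Complex.exp (Complex.I * (inner ℝ x u : ℝ)) *
      (Real.exp (-t * ‖u‖ ^ α) : ℝ) with hg
  have hre : ((∫ u, g u).re : ℂ) = ∫ u, g u := by
    -- The integral is real: conjugation is undone by the reflection `u ↦ -u`.
    rw [← Complex.conj_eq_iff_re, ← integral_conj, ← integral_neg_eq_self]
    refine integral_congr_ae (Eventually.of_forall fun u => ?_)
    simp only [hg, map_mul, Complex.conj_ofReal, ← Complex.exp_conj, Complex.conj_I, norm_neg,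
      inner_neg_right, Complex.ofReal_neg, map_neg]
    ring_nf
  have hcomp := Measure.integral_comp_smul volume g (-(2 * Real.pi))
  rw [Real.fourier_eq', stableDensity, Complex.ofReal_mul, hre]
  have : ∀ v : Space d, g (-(2 * Real.pi) • v)
      = Complex.exp (↑(-2 * Real.pi * inner ℝ v x) * Complex.I) • stableChar d α t v := by
    intro v
    simp only [hg, stableChar, norm_smul, inner_smul_right, norm_neg,
      Real.norm_of_nonneg Real.two_pi_pos.le, smul_eq_mul, real_inner_comm]
    congr 2
    push_cast
    ring
  simp only [← this]
  rw [hcomp, Complex.real_smul]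
  congr 2
  rw [finrank_euclideanSpace, Fintype.card_fin, abs_inv, abs_pow, abs_neg,
    abs_of_pos Real.two_pi_pos]

lemma stableDensity_eq_integral_cos (hd : 1 ≤ d) (hα : 0 < α) (ht : 0 < t) (x : Space d) :
    stableDensity d α t x = ((2 * Real.pi) ^ d)⁻¹ *
      ∫ u : Space d, Real.cos (inner ℝ x u) * Real.exp (-t * ‖u‖ ^ α) := by
  rw [stableDensity]
  congr 1
  have h := integral_re (integrable_cexp_mul_exp_neg hd hα ht x)
  simp only [RCLike.re_to_complex] at h
  rw [← h]
  refine integral_congr_ae (Eventually.of_forall fun u => ?_)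
  simp only [Complex.re_mul_ofReal, mul_comm Complex.I, Complex.exp_ofReal_mul_I_re]

/-- Here `|v|^α = (|v|²)^{α/2}` with `α/2 < 1`. The damping `e^{-a|v|²}` is removed by letting `a →
0`, dominated by `e^{-t|v|^α}`. -/
lemma stableDensity_nonneg (hd : 1 ≤ d) (hα : α ∈ Ioo (0 : ℝ) 2) (ht : 0 < t) (x : Space d) :
    0 ≤ stableDensity d α t x := by
  rw [stableDensity_eq_integral_cos hd hα.1 ht]
  refine mul_nonneg (by positivity) ?_
  have hpd := isRadialPosDef_exp_neg_rpow d (β := α / 2) (t := t)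
    ⟨by linarith [hα.1], by linarith [hα.2]⟩ ht.le
  have hpow : ∀ v : Space d, (‖v‖ ^ 2) ^ (α / 2) = ‖v‖ ^ α := fun v => by
    rw [← Real.rpow_natCast, ← Real.rpow_mul (norm_nonneg _)]
    congr 1
    push_cast
    ring
  set a : ℕ → ℝ := fun n => 1 / ((n : ℝ) + 1) with ha
  have hapos : ∀ n, 0 < a n := fun n => by positivity
  have halim : Tendsto a atTop (𝓝 0) := tendsto_one_div_add_atTop_nhds_zero_nat
  refine ge_of_tendsto (tendsto_integral_of_dominated_convergence
    (F := fun n v => Real.cos (inner ℝ x v) * (Real.exp (-a n * ‖v‖ ^ 2) *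
      Real.exp (-t * (‖v‖ ^ 2) ^ (α / 2))))
    (fun v : Space d => Real.exp (-t * ‖v‖ ^ α))
    (fun n => aestronglyMeasurable_radial hpd.measurable (a n) x)
    (integrable_exp_neg_mul_norm_rpow hd hα.1 ht)
    (fun n => Eventually.of_forall fun v => ?_)
    (Eventually.of_forall fun v => ?_)) (Eventually.of_forall fun n => hpd.nonneg _ (hapos n) x)
  · rw [norm_mul, norm_mul, hpow, Real.norm_of_nonneg (Real.exp_pos (-t * ‖v‖ ^ α)).le,
      Real.norm_of_nonneg (Real.exp_pos _).le, Real.norm_eq_abs]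
    have h1 : Real.exp (-a n * ‖v‖ ^ 2) ≤ 1 := Real.exp_le_one_iff.mpr (by
      have := mul_nonneg (hapos n).le (sq_nonneg ‖v‖); linarith)
    calc _ ≤ 1 * (1 * Real.exp (-t * ‖v‖ ^ α)) := by
          gcongr
          exact Real.abs_cos_le_one _
      _ = _ := by ring
  · simp only [hpow]
    refine Tendsto.const_mul _ ?_
    have h1 : Tendsto (fun n => Real.exp (-a n * ‖v‖ ^ 2)) atTop (𝓝 (Real.exp (-0 * ‖v‖ ^ 2))) :=
      (Real.continuous_exp.tendsto _).comp ((halim.neg).mul_const _)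
    simpa using h1.mul_const (Real.exp (-t * ‖v‖ ^ α))

lemma measurable_stableDensity (d : ℕ) (α : ℝ) :
    Measurable (fun p : ℝ × Space d => stableDensity d α p.1 p.2) := by
  unfold stableDensity
  refine Measurable.const_mul (Complex.measurable_re.comp (StronglyMeasurable.measurable ?_)) _
  refine StronglyMeasurable.integral_prod_right (f := fun (p : ℝ × Space d) (u : Space d) =>
    Complex.exp (Complex.I * (inner ℝ p.2 u : ℝ)) * (Real.exp (-p.1 * ‖u‖ ^ α) : ℝ)) ?_
  refine Measurable.stronglyMeasurable ?_
  refine Measurable.mul ?_ ?_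
  · exact (by fun_prop : Continuous fun a : (ℝ × Space d) × Space d =>
      Complex.exp (Complex.I * (inner ℝ a.1.2 a.2 : ℝ))).measurable
  · exact (by fun_prop : Measurable fun a : (ℝ × Space d) × Space d =>
      ((Real.exp (-a.1.1 * ‖a.2‖ ^ α) : ℝ) : ℂ))

lemma measurable_stableDensity_right (d : ℕ) (α t : ℝ) : Measurable (stableDensity d α t) :=
  Measurable.of_uncurry_left (f := stableDensity d α) (measurable_stableDensity d α)

/-- Moving the Fourier transform onto the Gaussian turns the integral into an average of the
characteristic function, of modulus at most `1`, against a Gaussian `G` of mass one. The damping is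
there because integrability of the density is not yet known. -/
lemma lintegral_stableDensity_mul_gaussian_le (hd : 1 ≤ d) (hα : α ∈ Ioo (0 : ℝ) 2) (ht : 0 < t)
    {a : ℝ} (ha : 0 < a) :
    ∫⁻ x : Space d, ENNReal.ofReal (stableDensity d α t x * Real.exp (-a * ‖x‖ ^ 2)) ≤ 1 := by
  have hmeas := measurable_stableDensity_right d α t
  have hgauss : Integrable (fun x : Space d => Complex.exp (-(a : ℂ) * ‖x‖ ^ 2)) := by
    have h := GaussianFourier.integrable_cexp_neg_mul_sq_norm_add (V := Space d)
      (b := (a : ℂ)) (by simpa using ha) 0 0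
    simp only [zero_mul, add_zero] at h
    exact h
  have hflip : ∫ ξ : Space d, 𝓕 (stableChar d α t) ξ • Complex.exp (-(a : ℂ) * ‖ξ‖ ^ 2)
      = ∫ x : Space d, stableChar d α t x •
        𝓕 (fun v : Space d => Complex.exp (-(a : ℂ) * ‖v‖ ^ 2)) x := by
    have := VectorFourier.integral_fourierIntegral_smul_eq_flip (L := innerₗ (Space d))
      (μ := volume) (ν := volume) Real.continuous_fourierChar
      continuous_inner (integrable_stableChar hd hα.1 ht) (hgauss)
    rw [flip_innerₗ] at this
    exact this
  have hint : Integrable (fun x : Space d =>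
      stableDensity d α t x * Real.exp (-a * ‖x‖ ^ 2)) := by
    have hbdd : ∀ x : Space d, ‖stableDensity d α t x‖ ≤ ∫ ξ : Space d, ‖stableChar d α t ξ‖ :=
      fun x => by
        rw [← Complex.norm_real, ofReal_stableDensity]
        exact VectorFourier.norm_fourierIntegral_le_integral_norm _ _ _ _ _
    exact (integrable_exp_neg_mul_sq_norm (ha)).bdd_mul hmeas.aestronglyMeasurable
      (Eventually.of_forall hbdd)
  rw [← ofReal_integral_eq_lintegral_ofReal hint (Eventually.of_forall fun x =>
    mul_nonneg (stableDensity_nonneg hd hα ht x) (Real.exp_pos _).le), ← ENNReal.ofReal_one]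
  refine ENNReal.ofReal_le_ofReal ?_
  set G : Space d → ℝ := fun ξ => (Real.pi / a) ^ ((d : ℝ) / 2) *
    Real.exp (-(Real.pi ^ 2 / a) * ‖ξ‖ ^ 2) with hG
  have hFG : ∀ ξ : Space d, 𝓕 (fun v : Space d => Complex.exp (-(a : ℂ) * ‖v‖ ^ 2)) ξ = G ξ := by
    intro ξ
    rw [fourier_gaussian_innerProductSpace (by simpa using ha), finrank_euclideanSpace,
      Fintype.card_fin, hG, Complex.ofReal_mul, Complex.ofReal_cpow
        (div_pos Real.pi_pos (ha)).le]
    push_cast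
    congr 2
    ring
  have hpa : 0 < Real.pi ^ 2 / a := div_pos (by positivity) (ha)
  have hGint : Integrable G := (integrable_exp_neg_mul_sq_norm hpa).const_mul _
  have hG1 : ∫ ξ, G ξ = 1 := by
    simp only [hG]
    rw [integral_const_mul, GaussianFourier.integral_rexp_neg_mul_sq_norm hpa,
      finrank_euclideanSpace, Fintype.card_fin, ← Real.mul_rpow
        (div_pos Real.pi_pos (ha)).le (div_pos Real.pi_pos hpa).le]
    have : Real.pi / a * (Real.pi / (Real.pi ^ 2 / a)) = 1 := by
      have := (ha).ne'
      have := Real.pi_ne_zero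
      field_simp
    rw [this, Real.one_rpow]
  have hcast : ((∫ x : Space d, stableDensity d α t x * Real.exp (-a * ‖x‖ ^ 2) : ℝ) : ℂ)
      = ∫ x : Space d, stableChar d α t x * G x := by
    rw [← integral_complex_ofReal]
    simp only [← hFG]
    simp only [smul_eq_mul] at hflip
    rw [← hflip]
    refine integral_congr_ae (Eventually.of_forall fun x => ?_)
    simp only [← ofReal_stableDensity]
    push_cast
    rfl
  calc _ ≤ ‖∫ x : Space d, stableDensity d α t x * Real.exp (-a * ‖x‖ ^ 2)‖ :=
        Real.le_norm_self _
    _ = ‖∫ x : Space d, stableChar d α t x * G x‖ := by rw [← hcast, Complex.norm_real]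
    _ ≤ ∫ ξ, G ξ := by
        refine norm_integral_le_of_norm_le hGint (Eventually.of_forall fun ξ => ?_)
        have hG0 : 0 ≤ G ξ := by
          have := (div_pos Real.pi_pos (ha)).le
          simp only [hG]; positivity
        rw [norm_mul, Complex.norm_real, Real.norm_of_nonneg hG0]
        exact mul_le_of_le_one_left hG0 (norm_stableChar_le ht.le ξ)
    _ = 1 := hG1

/-- Fatou as `a → 0`. The upper bound suffices: it gives integrability, hence Fourier inversion in
`integral_cexp_mul_stableDensity`. -/
lemma lintegral_stableDensity_le (hd : 1 ≤ d) (hα : α ∈ Ioo (0 : ℝ) 2) (ht : 0 < t) :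
    ∫⁻ x : Space d, ENNReal.ofReal (stableDensity d α t x) ≤ 1 := by
  set a : ℕ → ℝ := fun n => 1 / ((n : ℝ) + 1) with ha
  have hapos : ∀ n, 0 < a n := fun n => by positivity
  have halim : Tendsto a atTop (𝓝 0) := tendsto_one_div_add_atTop_nhds_zero_nat
  have hmeas := measurable_stableDensity_right d α t
  have hbound : ∀ n, ∫⁻ x : Space d, ENNReal.ofReal
      (stableDensity d α t x * Real.exp (-a n * ‖x‖ ^ 2)) ≤ 1 := fun n =>
    lintegral_stableDensity_mul_gaussian_le hd hα ht (hapos n)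
  have hlim : ∀ x : Space d, Tendsto (fun n => ENNReal.ofReal
      (stableDensity d α t x * Real.exp (-a n * ‖x‖ ^ 2))) atTop
      (𝓝 (ENNReal.ofReal (stableDensity d α t x))) := by
    intro x
    refine (ENNReal.continuous_ofReal.tendsto _).comp ?_
    have h1 : Tendsto (fun n => Real.exp (-a n * ‖x‖ ^ 2)) atTop (𝓝 (Real.exp (-0 * ‖x‖ ^ 2))) :=
      (Real.continuous_exp.tendsto _).comp ((halim.neg).mul_const _)
    simpa using h1.const_mul (stableDensity d α t x)
  calc ∫⁻ x : Space d, ENNReal.ofReal (stableDensity d α t x)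
      = ∫⁻ x : Space d, liminf (fun n => ENNReal.ofReal
          (stableDensity d α t x * Real.exp (-a n * ‖x‖ ^ 2))) atTop :=
        lintegral_congr fun x => (hlim x).liminf_eq.symm
    _ ≤ liminf (fun n => ∫⁻ x : Space d, ENNReal.ofReal
          (stableDensity d α t x * Real.exp (-a n * ‖x‖ ^ 2))) atTop :=
        lintegral_liminf_le fun n => (hmeas.mul (Continuous.measurable (by fun_prop))).ennreal_ofReal
    _ ≤ liminf (fun _ : ℕ => (1 : ℝ≥0∞)) atTop := liminf_le_liminf (Eventually.of_forall hbound)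
    _ = 1 := liminf_const 1

lemma integrable_stableDensity (hd : 1 ≤ d) (hα : α ∈ Ioo (0 : ℝ) 2) (ht : 0 < t) :
    Integrable (stableDensity d α t) := by
  refine ⟨(measurable_stableDensity_right d α t).aestronglyMeasurable, ?_⟩
  rw [hasFiniteIntegral_iff_ofReal (Eventually.of_forall (stableDensity_nonneg hd hα ht))]
  exact (lintegral_stableDensity_le hd hα ht).trans_lt ENNReal.one_lt_top

lemma integral_cexp_mul_stableDensity (hd : 1 ≤ d) (hα : α ∈ Ioo (0 : ℝ) 2) (ht : 0 < t)
    (ξ : Space d) :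
    ∫ y : Space d, Complex.exp (↑(2 * Real.pi * inner ℝ y ξ) * Complex.I) *
      (stableDensity d α t y : ℂ) = stableChar d α t ξ := by
  have h := Continuous.fourierInv_fourier_eq (continuous_stableChar (t := t) hα.1)
    (integrable_stableChar hd hα.1 ht) (by
      refine (integrable_stableDensity hd hα ht).ofReal.congr (Eventually.of_forall fun x => ?_)
      exact ofReal_stableDensity x)
  have h2 := congrFun h ξ
  rw [Real.fourierInv_eq'] at h2
  simpa only [← ofReal_stableDensity, smul_eq_mul] using h2

lemma continuousAt_stableDensity (hd : 1 ≤ d) (hα : 0 < α) (ht : 0 < t) (x : Space d) :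
    ContinuousAt (fun p : ℝ × Space d => stableDensity d α p.1 p.2) (t, x) := by
  unfold stableDensity
  refine ContinuousAt.mul continuousAt_const
    (Complex.continuous_re.continuousAt.comp (f := fun p : ℝ × Space d => ∫ u : Space d,
      Complex.exp (Complex.I * (inner ℝ p.2 u : ℝ)) * (Real.exp (-p.1 * ‖u‖ ^ α) : ℝ)) ?_)
  refine continuousAt_of_dominated (bound := fun u => Real.exp (-(t / 2) * ‖u‖ ^ α)) ?_ ?_
    (integrable_exp_neg_mul_norm_rpow hd hα (by positivity)) ?_
  · refine Eventually.of_forall fun p => Measurable.aestronglyMeasurable (Measurable.mul ?_ ?_)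
    · exact (by fun_prop : Continuous fun u : Space d =>
        Complex.exp (Complex.I * (inner ℝ p.2 u : ℝ))).measurable
    · fun_prop
  · have h1 : ∀ᶠ p : ℝ × Space d in 𝓝 (t, x), t / 2 < p.1 :=
      continuousAt_fst.eventually (lt_mem_nhds (show t / 2 < t by linarith))
    filter_upwards [h1] with p hp
    refine Eventually.of_forall fun u => ?_
    rw [norm_mul, mul_comm Complex.I, Complex.norm_exp_ofReal_mul_I, one_mul, Complex.norm_real,
      Real.norm_of_nonneg (Real.exp_pos _).le]
    gcongr
  · refine Eventually.of_forall fun u => Continuous.continuousAt ?_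
    fun_prop

/-- Positivity at the origin, with joint continuity, gives positivity in a neighbourhood, which is
all that `ae_jumpInt_lt_top` needs. -/
lemma stableDensity_zero_pos (hd : 1 ≤ d) (hα : 0 < α) (ht : 0 < t) :
    0 < stableDensity d α t 0 := by
  rw [stableDensity_eq_integral_cos hd hα ht]
  refine mul_pos (by positivity) ?_
  simp only [inner_zero_left, Real.cos_zero, one_mul]
  exact integral_exp_pos (integrable_exp_neg_mul_norm_rpow hd hα ht)

lemma measurable_stableTransition (d : ℕ) (α : ℝ) :
    Measurable (fun a : (ℝ × Space d) × (ℝ × Space d) =>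
      stableTransition d α a.1.1 a.1.2 a.2.1 a.2.2) := by
  unfold stableTransition
  refine Measurable.ite (measurableSet_lt (by fun_prop) (by fun_prop)) ?_ measurable_const
  exact (measurable_stableDensity d α).comp
    (f := fun a : (ℝ × Space d) × (ℝ × Space d) => (a.2.1 - a.1.1, a.2.2 - a.1.2)) (by fun_prop)

lemma stableTransition_nonneg (hd : 1 ≤ d) (hα : α ∈ Ioo (0 : ℝ) 2) (s : ℝ) (x : Space d)
    (t : ℝ) (y : Space d) : 0 ≤ stableTransition d α s x t y := by
  unfold stableTransition
  split_ifs with h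
  · exact stableDensity_nonneg hd hα (sub_pos.mpr h) _
  · exact le_rfl

lemma lintegral_stableTransition_le (hd : 1 ≤ d) (hα : α ∈ Ioo (0 : ℝ) 2) (s : ℝ) (x : Space d)
    (t : ℝ) : ∫⁻ y : Space d, ENNReal.ofReal (stableTransition d α s x t y) ≤ 1 := by
  unfold stableTransition
  split_ifs with h
  · rw [lintegral_sub_right_eq_self (fun y => ENNReal.ofReal (stableDensity d α (t - s) y)) x]
    exact lintegral_stableDensity_le hd hα (sub_pos.mpr h)
  · simp

end StableDensity

/-! ### Spatial Fourier transforms of test functions, with bounds uniform in time. -/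

section TestFunctions

open Filter Topology

variable {d : ℕ} {φ : ℝ × Space d → ℝ}

lemma exists_radius_of_hasCompactSupport {F : Type*} [Zero F] {f : ℝ × Space d → F}
    (hf : HasCompactSupport f) :
    ∃ R : ℝ, 0 ≤ R ∧ (∀ t y, R < |t| → f (t, y) = 0) ∧ (∀ t y, R < ‖y‖ → f (t, y) = 0) := by
  obtain ⟨R, hR⟩ := hf.isBounded.subset_closedBall (0 : ℝ × Space d)
  have key : ∀ q, f q ≠ 0 → ‖q‖ ≤ R := fun q hq => by
    have := hR (subset_tsupport f hq)
    simpa using this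
  refine ⟨max R 0, le_max_right _ _, fun t y h => ?_, fun t y h => ?_⟩
  · by_contra h0
    have h1 := key _ h0
    have h2 := (norm_fst_le (t, y)).trans h1
    rw [Real.norm_eq_abs] at h2
    exact absurd (h2.trans (le_max_left _ _)) (not_le.mpr h)
  · by_contra h0
    have h1 := key _ h0
    have h2 := (norm_snd_le (t, y)).trans h1
    exact absurd (h2.trans (le_max_left _ _)) (not_le.mpr h)

/-- The Fourier transform in the space variable. -/
noncomputable def sliceFourier (φ : ℝ × Space d → ℝ) (t : ℝ) (ξ : Space d) : ℂ :=
  𝓕 (fun y : Space d => (φ (t, y) : ℂ)) ξ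

/-- The time derivative. -/
noncomputable def timeDeriv (φ : ℝ × Space d → ℝ) (q : ℝ × Space d) : ℝ :=
  deriv (fun τ => φ (τ, q.2)) q.1

lemma hasDerivAt_slice (hφ : ContDiff ℝ ∞ φ) (t : ℝ) (y : Space d) :
    HasDerivAt (fun τ => φ (τ, y)) (fderiv ℝ φ (t, y) (1, 0)) t := by
  have h1 : HasFDerivAt φ (fderiv ℝ φ (t, y)) (t, y) :=
    (hφ.differentiable (by simp)).differentiableAt.hasFDerivAt
  have h2 : HasDerivAt (fun τ : ℝ => (τ, y)) ((1 : ℝ), (0 : Space d)) t :=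
    (hasDerivAt_id t).prodMk (hasDerivAt_const t y)
  exact h1.comp_hasDerivAt t h2

lemma timeDeriv_eq (hφ : ContDiff ℝ ∞ φ) : timeDeriv φ = fun q => fderiv ℝ φ q (1, 0) := by
  funext q
  exact (hasDerivAt_slice hφ q.1 q.2).deriv

lemma contDiff_timeDeriv (hφ : ContDiff ℝ ∞ φ) : ContDiff ℝ ∞ (timeDeriv φ) := by
  rw [timeDeriv_eq hφ]
  exact (hφ.fderiv_right (m := ∞) (by simp)).clm_apply contDiff_const

lemma hasCompactSupport_timeDeriv (hφ : ContDiff ℝ ∞ φ) (hc : HasCompactSupport φ) :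
    HasCompactSupport (timeDeriv φ) := by
  rw [timeDeriv_eq hφ]
  exact hc.fderiv_apply ℝ _

lemma hasCompactSupport_slice {F : Type*} [Zero F] {f : ℝ × Space d → F}
    (hf : HasCompactSupport f) (t : ℝ) : HasCompactSupport (fun y => f (t, y)) := by
  refine hf.comp_isClosedEmbedding (g := Prod.mk t) ⟨isEmbedding_prodMkRight t, ?_⟩
  have : range (Prod.mk t : Space d → ℝ × Space d) = {t} ×ˢ univ := by
    ext ⟨a, b⟩
    simp [eq_comm]
  rw [this]
  exact isClosed_singleton.prod isClosed_univ

lemma integrable_slice (hφ : Continuous φ) (hc : HasCompactSupport φ) (t : ℝ) :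
    Integrable (fun y => φ (t, y)) :=
  (by fun_prop : Continuous fun y => φ (t, y)).integrable_of_hasCompactSupport
    (hasCompactSupport_slice hc t)

lemma norm_iteratedFDeriv_slice_le {F : Type*} [NormedAddCommGroup F] [NormedSpace ℝ F]
    {f : ℝ × Space d → F} (hf : ContDiff ℝ ∞ f) (n : ℕ) (t : ℝ) (y : Space d) :
    ‖iteratedFDeriv ℝ n (fun y => f (t, y)) y‖ ≤ ‖iteratedFDeriv ℝ n f (t, y)‖ := by
  have e : (fun y => f (t, y))
      = (fun q => f ((t, 0) + q)) ∘ (ContinuousLinearMap.inr ℝ ℝ (Space d)) := by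
    funext y; simp
  have hf' : ContDiff ℝ ∞ (fun q => f ((t, 0) + q)) := by fun_prop
  rw [e, ContinuousLinearMap.iteratedFDeriv_comp_right _ hf' y (i := n) (by exact_mod_cast le_top),
    iteratedFDeriv_comp_add_left]
  refine (ContinuousMultilinearMap.norm_compContinuousLinearMap_le _ _).trans ?_
  simp only [ContinuousLinearMap.inr_apply, Prod.mk_add_mk, add_zero, zero_add]
  refine mul_le_of_le_one_right (norm_nonneg _) (Finset.prod_le_one (fun _ _ => norm_nonneg _)
    fun _ _ => ContinuousLinearMap.norm_inr_le_one ℝ ℝ (Space d))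

/-- All slices live in one ball, and their derivatives are dominated by those of the full function,
which are bounded. -/
lemma exists_integral_iteratedFDeriv_slice_le {F : Type*} [NormedAddCommGroup F] [NormedSpace ℝ F]
    {f : ℝ × Space d → F} (hf : ContDiff ℝ ∞ f) (hc : HasCompactSupport f) (n : ℕ) :
    ∃ C : ℝ, ∀ t, ∫ y, ‖iteratedFDeriv ℝ n (fun y => f (t, y)) y‖ ≤ C := by
  have hcont : Continuous fun q => iteratedFDeriv ℝ n f q :=
    hf.continuous_iteratedFDeriv (by exact_mod_cast le_top)
  obtain ⟨M, hM⟩ := hcont.bounded_above_of_compact_support (hc.iteratedFDeriv n)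
  obtain ⟨R, hR0, -, hR⟩ := exists_radius_of_hasCompactSupport
    (hc.iteratedFDeriv (𝕜 := ℝ) n)
  refine ⟨∫ y : Space d in Metric.closedBall 0 R, M, fun t => ?_⟩
  have hzero : ∀ y ∉ Metric.closedBall (0 : Space d) R,
      ‖iteratedFDeriv ℝ n (fun y => f (t, y)) y‖ = 0 := by
    intro y hy
    have h1 := norm_iteratedFDeriv_slice_le hf n t y
    rw [hR t y (by simpa using hy), norm_zero] at h1
    exact le_antisymm h1 (norm_nonneg _)
  rw [← setIntegral_eq_integral_of_forall_compl_eq_zero hzero]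
  refine setIntegral_mono_on ?_ ?_ measurableSet_closedBall
    fun y _ => (norm_iteratedFDeriv_slice_le hf n t y).trans (hM _)
  · have hs : ContDiff ℝ ∞ (fun y => f (t, y)) := by fun_prop
    exact (hs.continuous_iteratedFDeriv (m := n)
      (by exact_mod_cast le_top)).norm.continuousOn.integrableOn_compact (isCompact_closedBall _ _)
  · exact integrableOn_const (measure_closedBall_lt_top.ne)

lemma contDiff_ofReal_comp (hφ : ContDiff ℝ ∞ φ) : ContDiff ℝ ∞ (fun q => (φ q : ℂ)) :=
  Complex.ofRealCLM.contDiff.comp hφ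

lemma hasCompactSupport_ofReal_comp (hc : HasCompactSupport φ) :
    HasCompactSupport (fun q => (φ q : ℂ)) :=
  hc.comp_left (g := Complex.ofReal) Complex.ofReal_zero

lemma exists_pow_mul_norm_sliceFourier_le (hφ : ContDiff ℝ ∞ φ) (hc : HasCompactSupport φ)
    (n : ℕ) : ∃ C : ℝ, ∀ t ξ, ‖ξ‖ ^ n * ‖sliceFourier φ t ξ‖ ≤ C := by
  have hφ' := contDiff_ofReal_comp hφ
  have hc' := hasCompactSupport_ofReal_comp hc
  choose C hC using fun m => exists_integral_iteratedFDeriv_slice_le hφ' hc' m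
  refine ⟨2 ^ n * ∑ m ∈ Finset.range (n + 1), C m, fun t ξ => ?_⟩
  have hs : ContDiff ℝ ∞ (fun y => (φ (t, y) : ℂ)) := by
    exact hφ'.comp (contDiff_prodMk_right t)
  -- With `K = 0` the transform is not differentiated, so no moments of the slice enter.
  have h := Real.pow_mul_norm_iteratedFDeriv_fourier_le (K := 0) (N := ⊤)
    (f := fun y : Space d => (φ (t, y) : ℂ)) hs (by
      intro k m hk _
      have hk0 : k = 0 := by simpa using hk
      subst hk0
      simp only [pow_zero, one_mul]
      refine Continuous.integrable_of_hasCompactSupport ?_ ?_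
      · exact (hs.continuous_iteratedFDeriv (m := m) (by exact_mod_cast le_top)).norm
      · exact ((hasCompactSupport_slice hc' t).iteratedFDeriv m).norm)
    (k := 0) (n := n) (by simp) le_top ξ
  simp only [norm_iteratedFDeriv_zero] at h
  refine h.trans ?_
  simp only [pow_zero, one_mul, CharP.cast_eq_zero, mul_zero, zero_add, Finset.range_one,
    Finset.singleton_product, Finset.sum_map, Function.Embedding.coeFn_mk]
  gcongr with m hm
  exact hC m t

lemma exists_norm_sliceFourier_le (hφ : ContDiff ℝ ∞ φ) (hc : HasCompactSupport φ) (n : ℕ) :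
    ∃ C : ℝ, 0 ≤ C ∧ ∀ t ξ, ‖sliceFourier φ t ξ‖ ≤ C * ((1 + ‖ξ‖) ^ n)⁻¹ := by
  obtain ⟨C0, h0⟩ := exists_pow_mul_norm_sliceFourier_le hφ hc 0
  obtain ⟨C1, h1⟩ := exists_pow_mul_norm_sliceFourier_le hφ hc n
  have hC : ∀ t ξ, ‖sliceFourier φ t ξ‖ ≤ (2 ^ (n - 1) * (C0 + C1)) * ((1 + ‖ξ‖) ^ n)⁻¹ := by
    intro t ξ
    rw [← div_eq_mul_inv, le_div_iff₀ (by positivity)]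
    calc ‖sliceFourier φ t ξ‖ * (1 + ‖ξ‖) ^ n
        ≤ ‖sliceFourier φ t ξ‖ * (2 ^ (n - 1) * (1 ^ n + ‖ξ‖ ^ n)) := by
          gcongr
          exact add_pow_le zero_le_one (norm_nonneg _) n
      _ = 2 ^ (n - 1) * (‖ξ‖ ^ 0 * ‖sliceFourier φ t ξ‖ + ‖ξ‖ ^ n * ‖sliceFourier φ t ξ‖) := by
          ring
      _ ≤ _ := by
          gcongr
          · exact h0 t ξ
          · exact h1 t ξ
  refine ⟨2 ^ (n - 1) * (C0 + C1), ?_, hC⟩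
  have := (norm_nonneg _).trans (hC 0 0)
  simpa using this

lemma measurable_sliceFourier (hφ : Continuous φ) :
    Measurable (fun q : ℝ × Space d => sliceFourier φ q.1 q.2) := by
  simp only [sliceFourier, Real.fourier_eq']
  refine StronglyMeasurable.measurable (StronglyMeasurable.integral_prod_right
    (f := fun (q : ℝ × Space d) (v : Space d) =>
      Complex.exp (↑(-2 * Real.pi * inner ℝ v q.2) * Complex.I) • (φ (q.1, v) : ℂ)) ?_)
  refine Continuous.stronglyMeasurable ?_
  simp only [Function.uncurry_def]
  fun_prop

lemma measurable_sliceFourier_right (hφ : Continuous φ) (t : ℝ) :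
    Measurable (sliceFourier φ t) :=
  Measurable.of_uncurry_left (f := sliceFourier φ) (measurable_sliceFourier hφ)

lemma hasDerivAt_sliceFourier (hφ : ContDiff ℝ ∞ φ) (hc : HasCompactSupport φ) (t : ℝ)
    (ξ : Space d) :
    HasDerivAt (fun τ => sliceFourier φ τ ξ) (sliceFourier (timeDeriv φ) t ξ) t := by
  have hψ := (contDiff_timeDeriv hφ).continuous
  have hψc := hasCompactSupport_timeDeriv hφ hc
  obtain ⟨M, hM⟩ := hψ.bounded_above_of_compact_support hψc
  obtain ⟨R, hR0, -, hR⟩ := exists_radius_of_hasCompactSupport hψc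
  have hφc := hφ.continuous
  simp only [sliceFourier, Real.fourier_eq', smul_eq_mul]
  refine (hasDerivAt_integral_of_dominated_loc_of_deriv_le (s := univ) univ_mem
    (bound := (Metric.closedBall (0 : Space d) R).indicator fun _ => M)
    (F' := fun τ v => Complex.exp (↑(-2 * Real.pi * inner ℝ v ξ) * Complex.I) *
      (timeDeriv φ (τ, v) : ℂ)) ?_ ?_ ?_ ?_ ?_ ?_).2
  · exact Eventually.of_forall fun τ => Continuous.aestronglyMeasurable (by fun_prop)
  · refine Integrable.bdd_mul (c := 1) (integrable_slice hφc hc t).ofReal ?_ ?_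
    · exact Continuous.aestronglyMeasurable (by fun_prop)
    · exact Eventually.of_forall fun v => by rw [Complex.norm_exp_ofReal_mul_I]
  · exact Continuous.aestronglyMeasurable (by fun_prop)
  · refine Eventually.of_forall fun v τ _ => ?_
    rw [norm_mul, Complex.norm_exp_ofReal_mul_I, one_mul, Complex.norm_real]
    by_cases hv : v ∈ Metric.closedBall (0 : Space d) R
    · rw [indicator_of_mem hv]; exact hM _
    · rw [indicator_of_notMem hv, hR τ v (by simpa using hv), norm_zero]
  · rw [integrable_indicator_iff measurableSet_closedBall]
    exact integrableOn_const (measure_closedBall_lt_top.ne)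
  · refine Eventually.of_forall fun v τ _ => ?_
    refine HasDerivAt.const_mul _ (HasDerivAt.ofReal_comp ?_)
    rw [timeDeriv_eq hφ]
    exact hasDerivAt_slice hφ τ v

lemma fourierInv_sliceFourier (hφ : ContDiff ℝ ∞ φ) (hc : HasCompactSupport φ) (t : ℝ)
    (y : Space d) :
    ∫ ξ : Space d, Complex.exp (↑(2 * Real.pi * inner ℝ ξ y) * Complex.I) * sliceFourier φ t ξ
      = (φ (t, y) : ℂ) := by
  have hφc := hφ.continuous
  obtain ⟨C, hC0, hC⟩ := exists_norm_sliceFourier_le hφ hc (d + 1)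
  have hcont : Continuous (fun y => (φ (t, y) : ℂ)) := by fun_prop
  have hint : Integrable (fun y => (φ (t, y) : ℂ)) := (integrable_slice hφc hc t).ofReal
  have hF : Integrable (𝓕 (fun y => (φ (t, y) : ℂ))) := by
    refine Integrable.mono' ((integrable_one_add_norm (E := Space d) (r := (d + 1 : ℕ))
      (by simp)).const_mul C) ?_ ?_
    · exact (measurable_sliceFourier_right hφc t).aestronglyMeasurable
    · refine Eventually.of_forall fun ξ => (hC t ξ).trans (le_of_eq ?_)
      rw [Real.rpow_neg (by positivity), Real.rpow_natCast]
  have h := congrFun (hcont.fourierInv_fourier_eq hint hF) y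
  rw [Real.fourierInv_eq'] at h
  exact h

end TestFunctions

/-! ### The stable density as fundamental solution of `∂_t + Δ^{α/2}`. -/

section FreeEquation

open Filter Topology

variable {d : ℕ} {α : ℝ} {φ : ℝ × Space d → ℝ}

/-- The unperturbed operator `[∂_t + Δ_y^{α/2}] φ`. -/
noncomputable def freeGenerator (d : ℕ) (α : ℝ) (φ : ℝ × Space d → ℝ) (q : ℝ × Space d) : ℝ :=
  timeDeriv φ q + fracLaplacian d α (fun w => φ (q.1, w)) q.2

/-- The spatial Fourier transform of `[∂_t + Δ_y^{α/2}] φ`. -/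
noncomputable def generatorSymbol (α : ℝ) (φ : ℝ × Space d → ℝ) (t : ℝ) (ξ : Space d) : ℂ :=
  sliceFourier (timeDeriv φ) t ξ + ((-(2 * Real.pi * ‖ξ‖) ^ α : ℝ) : ℂ) * sliceFourier φ t ξ

lemma exists_norm_generatorSymbol_le (hα : α ∈ Ioo (0 : ℝ) 2) (hφ : ContDiff ℝ ∞ φ)
    (hc : HasCompactSupport φ) :
    ∃ B : Space d → ℝ, Integrable B ∧ (∀ ξ, 0 ≤ B ξ) ∧
      (∀ t ξ, ‖sliceFourier (timeDeriv φ) t ξ‖ ≤ B ξ) ∧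
      (∀ t ξ, ‖((-(2 * Real.pi * ‖ξ‖) ^ α : ℝ) : ℂ) * sliceFourier φ t ξ‖ ≤ B ξ) ∧
      ∀ t ξ, ‖generatorSymbol α φ t ξ‖ ≤ B ξ := by
  obtain ⟨C1, hC1, h1⟩ := exists_norm_sliceFourier_le (contDiff_timeDeriv hφ)
    (hasCompactSupport_timeDeriv hφ hc) (d + 1)
  -- Decay of order `d + 1` is integrable on `ℝᵈ`; the two further powers absorb `|ξ|^α ≤ (1+|ξ|)²`.
  obtain ⟨C2, hC2, h2⟩ := exists_norm_sliceFourier_le hφ hc (d + 3)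
  set w : Space d → ℝ := fun ξ => ((1 + ‖ξ‖) ^ (d + 1))⁻¹ with hw
  have hw0 : ∀ ξ, 0 ≤ w ξ := fun ξ => by positivity
  have hwint : Integrable w := by
    refine (integrable_one_add_norm (E := Space d) (r := (d + 1 : ℕ)) (by simp)).congr
      (Eventually.of_forall fun ξ => ?_)
    simp only [hw]
    rw [Real.rpow_neg (by positivity), Real.rpow_natCast]
  have h3 : ∀ t ξ, ‖((-(2 * Real.pi * ‖ξ‖) ^ α : ℝ) : ℂ) * sliceFourier φ t ξ‖
      ≤ (2 * Real.pi) ^ α * C2 * w ξ := by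
    intro t ξ
    rw [norm_mul, Complex.norm_real, norm_neg, Real.norm_of_nonneg (by positivity),
      Real.mul_rpow Real.two_pi_pos.le (norm_nonneg _)]
    have hp : ‖ξ‖ ^ α ≤ (1 + ‖ξ‖) ^ 2 := by
      calc ‖ξ‖ ^ α ≤ (1 + ‖ξ‖) ^ α :=
            Real.rpow_le_rpow (norm_nonneg _) (by linarith) hα.1.le
        _ ≤ (1 + ‖ξ‖) ^ (2 : ℝ) :=
            Real.rpow_le_rpow_of_exponent_le (by linarith [norm_nonneg ξ]) hα.2.le
        _ = _ := Real.rpow_two _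
    calc _ ≤ (2 * Real.pi) ^ α * (1 + ‖ξ‖) ^ 2 * (C2 * ((1 + ‖ξ‖) ^ (d + 3))⁻¹) := by
          gcongr
          exact h2 t ξ
      _ = _ := by
          have : (0 : ℝ) < 1 + ‖ξ‖ := by positivity
          simp only [hw]
          rw [show d + 3 = d + 1 + 2 by ring, pow_add (1 + ‖ξ‖) (d + 1) 2]
          field_simp
  refine ⟨fun ξ => (C1 + (2 * Real.pi) ^ α * C2) * w ξ, hwint.const_mul _,
    fun ξ => by have := hw0 ξ; positivity, fun t ξ => (h1 t ξ).trans ?_,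
    fun t ξ => (h3 t ξ).trans ?_,
    fun t ξ => (norm_add_le _ _).trans ((add_le_add (h1 t ξ) (h3 t ξ)).trans ?_)⟩
  · refine mul_le_mul_of_nonneg_right ?_ (hw0 ξ)
    have : 0 ≤ (2 * Real.pi) ^ α * C2 := by positivity
    linarith
  · refine mul_le_mul_of_nonneg_right ?_ (hw0 ξ)
    linarith
  · exact (add_mul _ _ _).ge

lemma measurable_generatorSymbol (hφ : ContDiff ℝ ∞ φ) :
    Measurable (fun q : ℝ × Space d => generatorSymbol α φ q.1 q.2) := by
  unfold generatorSymbol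
  refine (measurable_sliceFourier (contDiff_timeDeriv hφ).continuous).add
    (Measurable.mul ?_ (measurable_sliceFourier hφ.continuous))
  fun_prop

lemma measurable_generatorSymbol_right (hφ : ContDiff ℝ ∞ φ) (t : ℝ) :
    Measurable (generatorSymbol α φ t) :=
  Measurable.of_uncurry_left (f := generatorSymbol α φ) (measurable_generatorSymbol hφ)

lemma measurable_generatorSymbol_left (hφ : ContDiff ℝ ∞ φ) (ξ : Space d) :
    Measurable (fun t => generatorSymbol α φ t ξ) :=
  Measurable.of_uncurry_right (f := generatorSymbol α φ) (measurable_generatorSymbol hφ)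

lemma exists_generatorSymbol_eq_zero (α : ℝ) (hφ : ContDiff ℝ ∞ φ) (hc : HasCompactSupport φ) :
    ∃ R : ℝ, 0 ≤ R ∧ (∀ t ξ, R < |t| → sliceFourier φ t ξ = 0) ∧
      ∀ t ξ, R < |t| → generatorSymbol α φ t ξ = 0 := by
  obtain ⟨R1, hR1, h1, -⟩ := exists_radius_of_hasCompactSupport hc
  obtain ⟨R2, hR2, h2, -⟩ := exists_radius_of_hasCompactSupport
    (hasCompactSupport_timeDeriv hφ hc)
  have e1 : ∀ t ξ, max R1 R2 < |t| → sliceFourier φ t ξ = 0 := fun t ξ ht => by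
    simp [sliceFourier, Real.fourier_eq', h1 t _ ((le_max_left _ _).trans_lt ht)]
  refine ⟨max R1 R2, hR1.trans (le_max_left _ _), e1, fun t ξ ht => ?_⟩
  rw [generatorSymbol, e1 t ξ ht, mul_zero, add_zero]
  simp [sliceFourier, Real.fourier_eq', h2 t _ ((le_max_right _ _).trans_lt ht)]

lemma integrable_cexp_mul_of_norm_le {F : Space d → ℂ} {B : Space d → ℝ} (hB : Integrable B)
    (hF : Measurable F) (hFB : ∀ ξ, ‖F ξ‖ ≤ B ξ) (y : Space d) :
    Integrable fun ξ : Space d => Complex.exp (↑(2 * Real.pi * inner ℝ ξ y) * Complex.I) * F ξ := by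
  refine hB.mono' (AEStronglyMeasurable.mul (Continuous.aestronglyMeasurable (by fun_prop))
    hF.aestronglyMeasurable) (Eventually.of_forall fun ξ => ?_)
  rw [norm_mul, Complex.norm_exp_ofReal_mul_I, one_mul]
  exact hFB ξ

lemma freeGenerator_eq (hα : α ∈ Ioo (0 : ℝ) 2) (hφ : ContDiff ℝ ∞ φ) (hc : HasCompactSupport φ)
    (t : ℝ) (y : Space d) :
    freeGenerator d α φ (t, y) = (∫ ξ : Space d,
      Complex.exp (↑(2 * Real.pi * inner ℝ ξ y) * Complex.I) * generatorSymbol α φ t ξ).re := by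
  obtain ⟨B, hB, -, h1, h2, -⟩ := exists_norm_generatorSymbol_le hα hφ hc
  have m1 : Measurable (sliceFourier (timeDeriv φ) t) :=
    measurable_sliceFourier_right (contDiff_timeDeriv hφ).continuous t
  have m2 : Measurable (fun ξ : Space d =>
      ((-(2 * Real.pi * ‖ξ‖) ^ α : ℝ) : ℂ) * sliceFourier φ t ξ) := by
    exact Measurable.mul (by fun_prop) (measurable_sliceFourier_right hφ.continuous t)
  simp only [generatorSymbol, mul_add]
  rw [integral_add (integrable_cexp_mul_of_norm_le hB m1 (h1 t) y)
    (integrable_cexp_mul_of_norm_le hB m2 (h2 t) y), Complex.add_re,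
    fourierInv_sliceFourier (contDiff_timeDeriv hφ) (hasCompactSupport_timeDeriv hφ hc),
    Complex.ofReal_re, freeGenerator, fracLaplacian, Real.fourierInv_eq']
  rfl

lemma exists_abs_freeGenerator_le (hα : α ∈ Ioo (0 : ℝ) 2) (hφ : ContDiff ℝ ∞ φ)
    (hc : HasCompactSupport φ) : ∃ M : ℝ, ∀ q, |freeGenerator d α φ q| ≤ M := by
  obtain ⟨B, hB, -, -, -, h⟩ := exists_norm_generatorSymbol_le hα hφ hc
  refine ⟨∫ ξ, B ξ, fun ⟨t, y⟩ => ?_⟩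
  rw [freeGenerator_eq hα hφ hc]
  refine (Complex.abs_re_le_norm _).trans (norm_integral_le_of_norm_le hB
    (Eventually.of_forall fun ξ => ?_))
  rw [norm_mul, Complex.norm_exp_ofReal_mul_I, one_mul]
  exact h t ξ

lemma measurable_freeGenerator (hα : α ∈ Ioo (0 : ℝ) 2) (hφ : ContDiff ℝ ∞ φ)
    (hc : HasCompactSupport φ) : Measurable (freeGenerator d α φ) := by
  have : freeGenerator d α φ = fun q : ℝ × Space d => (∫ ξ : Space d,
      Complex.exp (↑(2 * Real.pi * inner ℝ ξ q.2) * Complex.I) *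
        generatorSymbol α φ q.1 ξ).re := by
    funext q
    exact freeGenerator_eq hα hφ hc q.1 q.2
  rw [this]
  refine Complex.measurable_re.comp (StronglyMeasurable.measurable
    (StronglyMeasurable.integral_prod_right (f := fun (q : ℝ × Space d) (ξ : Space d) =>
      Complex.exp (↑(2 * Real.pi * inner ℝ ξ q.2) * Complex.I) * generatorSymbol α φ q.1 ξ) ?_))
  refine Measurable.stronglyMeasurable (Measurable.mul ?_ ?_)
  · exact Continuous.measurable (by fun_prop)
  · exact (measurable_generatorSymbol hφ).comp
      (f := fun a : (ℝ × Space d) × Space d => (a.1.1, a.2)) (by fun_prop)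

lemma exists_freeGenerator_eq_zero (hα : α ∈ Ioo (0 : ℝ) 2) (hφ : ContDiff ℝ ∞ φ)
    (hc : HasCompactSupport φ) : ∃ R : ℝ, 0 ≤ R ∧ ∀ t y, R < |t| → freeGenerator d α φ (t, y) = 0 := by
  obtain ⟨R, hR0, -, hR⟩ := exists_generatorSymbol_eq_zero α hφ hc
  refine ⟨R, hR0, fun t y ht => ?_⟩
  simp [freeGenerator_eq hα hφ hc, hR t _ ht]

/-- Fubini in `(y, ξ)`, justified by integrability of the density and of the symbol. The phase
factors through `y - x`, and the `y`-integral becomes the characteristic function. -/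
lemma integral_stableDensity_mul_freeGenerator (hd : 1 ≤ d) (hα : α ∈ Ioo (0 : ℝ) 2)
    (hφ : ContDiff ℝ ∞ φ) (hc : HasCompactSupport φ) {τ : ℝ} (hτ : 0 < τ) (x : Space d) (t : ℝ) :
    ∫ y : Space d, stableDensity d α τ (y - x) * freeGenerator d α φ (t, y)
      = (∫ ξ : Space d, Complex.exp (↑(2 * Real.pi * inner ℝ ξ x) * Complex.I) *
          (generatorSymbol α φ t ξ * stableChar d α τ ξ)).re := by
  obtain ⟨B, hB, hB0, -, -, hM⟩ := exists_norm_generatorSymbol_le hα hφ hc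
  have hP := integrable_stableDensity hd hα hτ
  have hPx : Integrable (fun y => stableDensity d α τ (y - x)) := hP.comp_sub_right x
  have mM : Measurable (generatorSymbol α φ t) :=
    measurable_generatorSymbol_right hφ t
  have hMint : Integrable (generatorSymbol α φ t) :=
    hB.mono' mM.aestronglyMeasurable (Eventually.of_forall (hM t))
  set E : Space d → Space d → ℂ := fun ξ y =>
    Complex.exp (↑(2 * Real.pi * inner ℝ ξ y) * Complex.I) with hE
  have hEn : ∀ ξ y, ‖E ξ y‖ = 1 := fun ξ y => Complex.norm_exp_ofReal_mul_I _
  have hjoint : Integrable (Function.uncurry fun y ξ =>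
      (stableDensity d α τ (y - x) : ℂ) * (E ξ y * generatorSymbol α φ t ξ))
      (volume.prod volume) := by
    have h0 := hPx.ofReal (𝕜 := ℂ) |>.mul_prod hMint
    have h1 := h0.bdd_mul (c := 1) (f := fun p : Space d × Space d => E p.2 p.1)
      (Continuous.aestronglyMeasurable (by fun_prop)) (Eventually.of_forall fun p => (hEn _ _).le)
    refine h1.congr (Eventually.of_forall fun p => ?_)
    exact mul_left_comm _ _ _
  have hre := integral_re hjoint.integral_prod_left
  simp only [RCLike.re_to_complex, Function.uncurry] at hre
  have step1 : ∫ y : Space d, stableDensity d α τ (y - x) * freeGenerator d α φ (t, y)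
      = (∫ y : Space d, ∫ ξ : Space d, (stableDensity d α τ (y - x) : ℂ) *
        (E ξ y * generatorSymbol α φ t ξ)).re := by
    rw [← hre]
    refine integral_congr_ae (Eventually.of_forall fun y => ?_)
    simp only
    rw [integral_const_mul, Complex.re_ofReal_mul, freeGenerator_eq hα hφ hc]
  rw [step1, integral_integral_swap hjoint]
  congr 1
  refine integral_congr_ae (Eventually.of_forall fun ξ => ?_)
  simp only
  rw [← integral_cexp_mul_stableDensity hd hα hτ ξ,
    ← integral_sub_right_eq_self (fun y : Space d =>
      Complex.exp (↑(2 * Real.pi * inner ℝ y ξ) * Complex.I) * (stableDensity d α τ y : ℂ)) x,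
    ← integral_const_mul, ← integral_const_mul]
  refine integral_congr_ae (Eventually.of_forall fun y => ?_)
  have : E ξ y = E ξ x * Complex.exp (↑(2 * Real.pi * inner ℝ (y - x) ξ) * Complex.I) := by
    simp only [hE]
    rw [← Complex.exp_add, inner_sub_left, real_inner_comm ξ y, real_inner_comm ξ x]
    congr 1
    push_cast
    ring
  simp only [this]
  simp only [hE]
  ring

/-- For fixed frequency the integrand is the exact time derivative of `φ̂(t,ξ) e^{-(t-s)|2πξ|^α}`.
The upper boundary term vanishes by compact support, and at `t = s` the exponential is `1`. -/
lemma integral_generatorSymbol_mul_stableChar (hα : α ∈ Ioo (0 : ℝ) 2) (hφ : ContDiff ℝ ∞ φ)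
    (hc : HasCompactSupport φ) (s : ℝ) (ξ : Space d) :
    ∫ t in Ioi s, generatorSymbol α φ t ξ * stableChar d α (t - s) ξ = -sliceFourier φ s ξ := by
  obtain ⟨R, hR0, hR, hR'⟩ := exists_generatorSymbol_eq_zero α hφ hc
  have hderiv : ∀ t, HasDerivAt (fun t => sliceFourier φ t ξ * stableChar d α (t - s) ξ)
      (generatorSymbol α φ t ξ * stableChar d α (t - s) ξ) t := by
    intro t
    have h1 := hasDerivAt_sliceFourier hφ hc t ξ
    have h2 : HasDerivAt (fun t => stableChar d α (t - s) ξ)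
        (((-(2 * Real.pi * ‖ξ‖) ^ α : ℝ) : ℂ) * stableChar d α (t - s) ξ) t := by
      unfold stableChar
      have h3 : HasDerivAt (fun t => -(t - s) * (2 * Real.pi * ‖ξ‖) ^ α)
          (-1 * (2 * Real.pi * ‖ξ‖) ^ α) t :=
        (((hasDerivAt_id t).sub_const s).neg).mul_const _
      convert h3.exp.ofReal_comp using 1
      push_cast
      ring
    refine (h1.mul h2).congr_deriv ?_
    simp only [generatorSymbol]
    ring
  obtain ⟨B, hB, hB0, -, -, hM⟩ := exists_norm_generatorSymbol_le hα hφ hc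
  have hmeas : Measurable (fun t => generatorSymbol α φ t ξ * stableChar d α (t - s) ξ) := by
    refine Measurable.mul (measurable_generatorSymbol_left hφ ξ) ?_
    unfold stableChar
    fun_prop
  have hint : IntegrableOn (fun t => generatorSymbol α φ t ξ * stableChar d α (t - s) ξ)
      (Ioi s) := by
    have hdom : Integrable ((Icc (-R) R).indicator fun _ : ℝ => B ξ) := by
      rw [integrable_indicator_iff measurableSet_Icc]
      exact integrableOn_const (by simp)
    refine hdom.integrableOn.mono' hmeas.aestronglyMeasurable ?_
    filter_upwards [ae_restrict_mem measurableSet_Ioi] with t ht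
    by_cases htR : t ∈ Icc (-R) R
    · rw [indicator_of_mem htR, norm_mul]
      have h1 := norm_stableChar_le (α := α) (sub_pos.mpr ht).le ξ
      calc _ ≤ B ξ * 1 := mul_le_mul (hM t ξ) h1 (norm_nonneg _) (hB0 ξ)
        _ = B ξ := mul_one _
    · rw [indicator_of_notMem htR, hR' t ξ (by
        rw [mem_Icc, ← abs_le] at htR
        exact not_le.mp htR), zero_mul, norm_zero]
  have hlim : Tendsto (fun t => sliceFourier φ t ξ * stableChar d α (t - s) ξ) atTop (𝓝 0) := by
    refine tendsto_const_nhds.congr' ?_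
    filter_upwards [eventually_gt_atTop R] with t ht
    rw [hR t ξ (ht.trans_le (le_abs_self t)), zero_mul]
  rw [integral_Ioi_of_hasDerivAt_of_tendsto' (fun t _ => hderiv t) hint hlim]
  simp [stableChar]

/-- The nonlocal operator destroys compact support in space but not in time. A bounded function
vanishing outside a time interval suffices, as each `p(s,x,t,·)` has mass at most one. -/
lemma lintegral_stableTransition_mul_lt_top (hd : 1 ≤ d) (hα : α ∈ Ioo (0 : ℝ) 2)
    (hφ : ContDiff ℝ ∞ φ) (hc : HasCompactSupport φ) (s : ℝ) (x : Space d) :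
    ∫⁻ q : ℝ × Space d, ENNReal.ofReal (stableTransition d α s x q.1 q.2) *
      ENNReal.ofReal |freeGenerator d α φ q| < ⊤ := by
  obtain ⟨M, hM⟩ := exists_abs_freeGenerator_le hα hφ hc
  obtain ⟨R, hR0, hR⟩ := exists_freeGenerator_eq_zero hα hφ hc
  have mp : Measurable (fun q : ℝ × Space d =>
      ENNReal.ofReal (stableTransition d α s x q.1 q.2)) :=
    ((measurable_stableTransition d α).comp
      (f := fun q : ℝ × Space d => ((s, x), q)) (by fun_prop)).ennreal_ofReal
  have mg := ((measurable_freeGenerator hα hφ hc).norm).ennreal_ofReal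
  rw [Measure.volume_eq_prod, lintegral_prod]
  swap
  · exact (mp.mul mg).aemeasurable
  calc _ ≤ ∫⁻ t : ℝ, (Icc (-R) R).indicator (fun _ => ENNReal.ofReal M) t := by
        refine lintegral_mono fun t => ?_
        by_cases htR : t ∈ Icc (-R) R
        · rw [indicator_of_mem htR]
          calc _ ≤ ∫⁻ y : Space d, ENNReal.ofReal (stableTransition d α s x t y) *
                  ENNReal.ofReal M := by
                refine lintegral_mono fun y => ?_
                gcongr
                exact hM _
            _ = (∫⁻ y : Space d, ENNReal.ofReal (stableTransition d α s x t y)) *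
                  ENNReal.ofReal M := lintegral_mul_const _ (mp.comp measurable_prodMk_left)
            _ ≤ 1 * ENNReal.ofReal M := by
                gcongr
                exact lintegral_stableTransition_le hd hα s x t
            _ = _ := one_mul _
        · rw [indicator_of_notMem htR]
          rw [mem_Icc, ← abs_le, not_le] at htR
          simp [hR t _ htR]
    _ = ENNReal.ofReal M * volume (Icc (-R) R) := lintegral_indicator_const measurableSet_Icc _
    _ < ⊤ := ENNReal.mul_lt_top ENNReal.ofReal_lt_top (by simp)

lemma integrable_stableTransition_mul_freeGenerator (hd : 1 ≤ d) (hα : α ∈ Ioo (0 : ℝ) 2)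
    (hφ : ContDiff ℝ ∞ φ) (hc : HasCompactSupport φ) (s : ℝ) (x : Space d) :
    Integrable fun q : ℝ × Space d =>
      stableTransition d α s x q.1 q.2 * freeGenerator d α φ q := by
  have mp : Measurable (fun q : ℝ × Space d => stableTransition d α s x q.1 q.2) :=
    (measurable_stableTransition d α).comp (f := fun q : ℝ × Space d => ((s, x), q)) (by fun_prop)
  refine ⟨(mp.mul (measurable_freeGenerator hα hφ hc)).aestronglyMeasurable, ?_⟩
  rw [hasFiniteIntegral_iff_norm]
  refine lt_of_eq_of_lt (lintegral_congr fun q => ?_)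
    (lintegral_stableTransition_mul_lt_top hd hα hφ hc s x)
  rw [norm_mul, Real.norm_of_nonneg (stableTransition_nonneg hd hα _ _ _ _),
    ENNReal.ofReal_mul (stableTransition_nonneg hd hα _ _ _ _)]
  rfl

/-- The stable transition density is the fundamental solution of `∂_t + Δ^{α/2}`. -/
theorem integral_stableTransition_mul_freeGenerator (hd : 1 ≤ d) (hα : α ∈ Ioo (0 : ℝ) 2)
    (hφ : ContDiff ℝ ∞ φ) (hc : HasCompactSupport φ) (s : ℝ) (x : Space d) :
    ∫ q : ℝ × Space d, stableTransition d α s x q.1 q.2 * freeGenerator d α φ q = -φ (s, x) := by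
  have hint := integrable_stableTransition_mul_freeGenerator hd hα hφ hc s x
  obtain ⟨B, hB, hB0, -, -, hM⟩ := exists_norm_generatorSymbol_le hα hφ hc
  obtain ⟨R, hR0, hR, hR'⟩ := exists_generatorSymbol_eq_zero α hφ hc
  set E : Space d → ℂ := fun ξ =>
    Complex.exp (↑(2 * Real.pi * inner ℝ ξ x) * Complex.I) with hE
  have hEn : ∀ ξ, ‖E ξ‖ = 1 := fun ξ => Complex.norm_exp_ofReal_mul_I _
  have hjoint : Integrable (Function.uncurry fun t ξ =>
      E ξ * (generatorSymbol α φ t ξ * stableChar d α (t - s) ξ))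
      ((volume.restrict (Ioi s)).prod volume) := by
    have hdom : Integrable ((Icc (-R) R).indicator fun _ : ℝ => (1 : ℝ)) := by
      rw [integrable_indicator_iff measurableSet_Icc]
      exact integrableOn_const (by simp)
    refine (hdom.restrict (s := Ioi s) |>.mul_prod hB).mono' ?_ ?_
    · refine Measurable.aestronglyMeasurable (Measurable.mul ?_ (Measurable.mul ?_ ?_))
      · exact Continuous.measurable (by fun_prop)
      · exact measurable_generatorSymbol hφ
      · unfold stableChar
        fun_prop
    · have hsupp : ∀ᵐ p : ℝ × Space d ∂((volume.restrict (Ioi s)).prod volume), p.1 ∈ Ioi s :=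
        Measure.quasiMeasurePreserving_fst.ae (ae_restrict_mem measurableSet_Ioi)
      filter_upwards [hsupp] with p hp
      simp only [Function.uncurry]
      rw [norm_mul, hEn, one_mul, norm_mul]
      by_cases htR : p.1 ∈ Icc (-R) R
      · rw [indicator_of_mem htR, one_mul]
        have h1 := norm_stableChar_le (α := α) (sub_pos.mpr hp).le p.2
        calc _ ≤ B p.2 * 1 := mul_le_mul (hM _ _) h1 (norm_nonneg _) (hB0 _)
          _ = B p.2 := mul_one _
      · rw [indicator_of_notMem htR, hR' p.1 p.2 (by
          rw [mem_Icc, ← abs_le] at htR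
          exact not_le.mp htR), norm_zero, zero_mul, zero_mul]
  rw [Measure.volume_eq_prod, integral_prod _ hint]
  have h1 : ∀ t, ∫ y : Space d, stableTransition d α s x t y * freeGenerator d α φ (t, y)
      = (Ioi s).indicator (fun t => (∫ ξ : Space d,
          E ξ * (generatorSymbol α φ t ξ * stableChar d α (t - s) ξ)).re) t := by
    intro t
    by_cases ht : t ∈ Ioi s
    · have ht' : s < t := ht
      rw [indicator_of_mem ht, ← integral_stableDensity_mul_freeGenerator hd hα hφ hc
        (sub_pos.mpr ht') x t]
      simp only [stableTransition, if_pos ht']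
    · have ht' : ¬ s < t := ht
      rw [indicator_of_notMem ht]
      simp only [stableTransition, if_neg ht', zero_mul, integral_zero]
  simp only [h1]
  rw [integral_indicator measurableSet_Ioi]
  have h2 := integral_re hjoint.integral_prod_left
  simp only [RCLike.re_to_complex, Function.uncurry] at h2
  rw [h2, integral_integral_swap hjoint]
  have h3 : ∀ ξ, ∫ t in Ioi s, E ξ * (generatorSymbol α φ t ξ * stableChar d α (t - s) ξ)
      = -(E ξ * sliceFourier φ s ξ) := by
    intro ξ
    rw [integral_const_mul, integral_generatorSymbol_mul_stableChar hα hφ hc, mul_neg]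
  simp only [h3]
  rw [integral_neg, fourierInv_sliceFourier hφ hc s x, Complex.neg_re, Complex.ofReal_re]

end FreeEquation

/-! ### The perturbed density: finiteness, and the equation it solves. -/

section Perturbation

open Filter Topology

variable {d : ℕ} {α η c : ℝ} {j : Space d → Space d → ℝ} {φ : ℝ × Space d → ℝ}

/-- The stable transition density as an extended nonnegative kernel. -/
noncomputable def stableKernel (d : ℕ) (α : ℝ) (p q : ℝ × Space d) : ℝ≥0∞ :=
  ENNReal.ofReal (stableTransition d α p.1 p.2 q.1 q.2)

/-- The perturbed stable density as a function of two space-time points. -/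
noncomputable def perturbedKernel (d : ℕ) (α : ℝ) (j : Space d → Space d → ℝ)
    (p q : ℝ × Space d) : ℝ≥0∞ :=
  perturbedStable d α j p.1 p.2 q.1 q.2

lemma measurable_stableKernel (d : ℕ) (α : ℝ) :
    Measurable (Function.uncurry (stableKernel d α)) :=
  (measurable_stableTransition d α).ennreal_ofReal

lemma measurable_stableKernel_right (d : ℕ) (α : ℝ) (p : ℝ × Space d) :
    Measurable (stableKernel d α p) :=
  Measurable.of_uncurry_left (measurable_stableKernel d α)

lemma stableKernel_eq_zero {s t : ℝ} {x y : Space d} (h : t ≤ s) :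
    ENNReal.ofReal (stableTransition d α s x t y) = 0 := by
  simp [stableTransition, not_lt.mpr h]

lemma measurable_ofReal_jump (hj : Measurable (Function.uncurry j)) :
    Measurable (Function.uncurry fun z w => ENNReal.ofReal (j z w)) :=
  hj.ennreal_ofReal

lemma seriesTerm_zero_stable (j : Space d → Space d → ℝ≥0∞) :
    seriesTerm (fun s x t y => ENNReal.ofReal (stableTransition d α s x t y)) j 0
      = stableKernel d α := by
  funext p q
  simp only [seriesTerm, perturbTerm, stableKernel]

lemma measurable_seriesTerm_zero_stable (j : Space d → Space d → ℝ≥0∞) :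
    Measurable (Function.uncurry (seriesTerm
      (fun s x t y => ENNReal.ofReal (stableTransition d α s x t y)) j 0)) := by
  rw [seriesTerm_zero_stable]
  exact measurable_stableKernel d α

lemma perturbedKernel_eq_tsum (d : ℕ) (α : ℝ) (j : Space d → Space d → ℝ) :
    perturbedKernel d α j = fun p q => ∑' n, seriesTerm
      (fun s x t y => ENNReal.ofReal (stableTransition d α s x t y))
      (fun z w => ENNReal.ofReal (j z w)) n p q := by
  funext p q
  simp only [perturbedKernel, perturbedStable, perturbation, seriesTerm]

lemma seriesTerm_one_le (hη : 0 ≤ η) (hc : 0 ≤ c) (hj : Measurable (Function.uncurry j))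
    (hsmall : SmallFirstTerm d α j η c) (p q : ℝ × Space d) :
    seriesTerm (fun s x t y => ENNReal.ofReal (stableTransition d α s x t y))
        (fun z w => ENNReal.ofReal (j z w)) 1 p q
      ≤ ENNReal.ofReal (η + c * (q.1 - p.1)) * stableKernel d α p q := by
  rcases le_or_gt q.1 p.1 with h | h
  · rw [seriesTerm_eq_zero (fun _ _ _ _ h => stableKernel_eq_zero h) 1 h]
    exact zero_le
  · have h0 : 0 ≤ η + c * (q.1 - p.1) := by
      have := sub_nonneg.mpr h.le
      positivity
    rw [stableKernel, ← ENNReal.ofReal_mul h0]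
    refine le_of_eq_of_le ?_ (hsmall p.1 q.1 p.2 q.2 h)
    simp only [seriesTerm, perturbTerm]
    refine lintegral_congr fun u => lintegral_congr fun z => ?_
    rw [← lintegral_const_mul]
    · simp only [mul_assoc]
    · have h1 : Measurable fun w => ENNReal.ofReal (j z w) :=
        (measurable_ofReal_jump hj).comp (f := fun w => (z, w)) (by fun_prop)
      have h2 : Measurable fun w => ENNReal.ofReal (stableTransition d α u w q.1 q.2) :=
        (measurable_stableKernel d α).comp (f := fun w => ((u, w), q)) (by fun_prop)
      exact h1.mul h2

lemma exists_perturbedKernel_le (hη : 0 ≤ η) (hη1 : η < 1) (hc : 0 ≤ c)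
    (hj : Measurable (Function.uncurry j)) (hsmall : SmallFirstTerm d α j η c) (T : ℝ) :
    ∃ C : ℝ≥0∞, C ≠ ⊤ ∧ ∀ p q : ℝ × Space d, q.1 - p.1 ≤ T →
      perturbedKernel d α j p q ≤ C * stableKernel d α p q := by
  have h1 := seriesTerm_one_le hη hc hj hsmall
  rw [← seriesTerm_zero_stable fun z w => ENNReal.ofReal (j z w)] at h1 ⊢
  rw [perturbedKernel_eq_tsum]
  exact exists_tsum_seriesTerm_le (measurable_ofReal_jump hj)
    (fun _ _ _ _ h => stableKernel_eq_zero h) (measurable_seriesTerm_zero_stable _) hη hη1 hc h1 T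

lemma perturbedKernel_ne_top (hη : 0 ≤ η) (hη1 : η < 1) (hc : 0 ≤ c)
    (hj : Measurable (Function.uncurry j)) (hsmall : SmallFirstTerm d α j η c)
    (p q : ℝ × Space d) : perturbedKernel d α j p q ≠ ⊤ := by
  obtain ⟨C, hC, h⟩ := exists_perturbedKernel_le hη hη1 hc hj hsmall (q.1 - p.1)
  exact ((h p q le_rfl).trans_lt (ENNReal.mul_lt_top hC.lt_top ENNReal.ofReal_lt_top)).ne

lemma measurable_perturbedKernel (hj : Measurable (Function.uncurry j)) :
    Measurable (Function.uncurry (perturbedKernel d α j)) := by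
  rw [perturbedKernel_eq_tsum]
  exact Measurable.tsum fun n => (seriesTerm_succ_and_measurable (measurable_ofReal_jump hj)
    (fun _ _ _ _ h => stableKernel_eq_zero h) (measurable_seriesTerm_zero_stable _) n).1

lemma measurable_perturbedKernel_right (hj : Measurable (Function.uncurry j)) (p : ℝ × Space d) :
    Measurable (perturbedKernel d α j p) :=
  Measurable.of_uncurry_left (measurable_perturbedKernel hj)

lemma perturbedKernel_eq (hj : Measurable (Function.uncurry j)) (p q : ℝ × Space d) :
    perturbedKernel d α j p q = stableKernel d α p q +
      compJump (fun z w => ENNReal.ofReal (j z w)) (perturbedKernel d α j) (stableKernel d α) p q := by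
  rw [← seriesTerm_zero_stable fun z w => ENNReal.ofReal (j z w), perturbedKernel_eq_tsum]
  exact tsum_seriesTerm_eq (measurable_ofReal_jump hj)
    (fun _ _ _ _ h => stableKernel_eq_zero h) (measurable_seriesTerm_zero_stable _) p q

/-- The integral of `J h` against the perturbed density. -/
noncomputable def jumpPotential (α : ℝ) (j : Space d → Space d → ℝ) (p : ℝ × Space d)
    (h : ℝ × Space d → ℝ≥0∞) : ℝ≥0∞ :=
  ∫⁻ r, perturbedKernel d α j p r * jumpInt (fun z w => ENNReal.ofReal (j z w)) h r

/-- The integral of `h` against the stable density. -/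
noncomputable def stablePotential (α : ℝ) (h : ℝ × Space d → ℝ≥0∞) (p : ℝ × Space d) : ℝ≥0∞ :=
  ∫⁻ q, stableKernel d α p q * h q

/-- The perturbation equation integrated against `h`. In `[0,∞]` it also yields `P̃ J P h ≤ P̃ h`,
the source of all finiteness for the jump term. -/
lemma lintegral_perturbedKernel_mul (hj : Measurable (Function.uncurry j)) (p : ℝ × Space d)
    {h : ℝ × Space d → ℝ≥0∞} (hh : Measurable h) :
    ∫⁻ q, perturbedKernel d α j p q * h q
      = stablePotential α h p + jumpPotential α j p (stablePotential α h) := by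
  simp only [perturbedKernel_eq hj p, add_mul]
  have hm : Measurable fun q => stableKernel d α p q * h q :=
    (measurable_stableKernel_right d α p).mul hh
  rw [lintegral_add_left hm,
    lintegral_compJump_mul (measurable_ofReal_jump hj) (measurable_perturbedKernel hj)
      (measurable_stableKernel d α) hh]
  rfl

lemma jumpPotential_mono (p : ℝ × Space d) {h h' : ℝ × Space d → ℝ≥0∞} (hh : ∀ r, h r ≤ h' r) :
    jumpPotential α j p h ≤ jumpPotential α j p h' :=
  lintegral_mono fun r => mul_le_mul_right (jumpInt_mono _ hh r) _

lemma jumpPotential_add (hj : Measurable (Function.uncurry j)) (p : ℝ × Space d)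
    {h h' : ℝ × Space d → ℝ≥0∞} (hh : Measurable h) :
    jumpPotential α j p (fun r => h r + h' r)
      = jumpPotential α j p h + jumpPotential α j p h' := by
  unfold jumpPotential
  have hm : Measurable fun r =>
      perturbedKernel d α j p r * jumpInt (fun z w => ENNReal.ofReal (j z w)) h r :=
    (measurable_perturbedKernel_right hj p).mul (measurable_jumpInt (measurable_ofReal_jump hj) hh)
  rw [← lintegral_add_left hm]
  refine lintegral_congr fun r => ?_
  rw [← mul_add, jumpInt, jumpInt, jumpInt, ← lintegral_add_left]
  · simp only [mul_add]
  · exact ((measurable_ofReal_jump hj).comp (f := fun w => (r.2, w)) (by fun_prop)).mul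
      (hh.comp (f := fun w => (r.1, w)) (by fun_prop))

lemma measurable_stablePotential {h : ℝ × Space d → ℝ≥0∞} (hh : Measurable h) :
    Measurable (stablePotential α h) :=
  Measurable.lintegral_prod_right'
    (f := fun a : (ℝ × Space d) × (ℝ × Space d) => stableKernel d α a.1 a.2 * h a.2)
    ((measurable_stableKernel d α).mul (hh.comp measurable_snd))

lemma lintegral_perturbedKernel_mul_lt_top (hd : 1 ≤ d) (hα : α ∈ Ioo (0 : ℝ) 2) (hη : 0 ≤ η)
    (hη1 : η < 1) (hc : 0 ≤ c) (hj : Measurable (Function.uncurry j))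
    (hsmall : SmallFirstTerm d α j η c) (hφ : ContDiff ℝ ∞ φ) (hφc : HasCompactSupport φ)
    (p : ℝ × Space d) :
    ∫⁻ q, perturbedKernel d α j p q * ENNReal.ofReal |freeGenerator d α φ q| < ⊤ := by
  obtain ⟨R, hR0, hR⟩ := exists_freeGenerator_eq_zero hα hφ hφc
  -- Only final times up to `R` contribute, so one comparison constant for spans up to `R - p.1` is
  -- enough.
  obtain ⟨C, hC, hle⟩ := exists_perturbedKernel_le hη hη1 hc hj hsmall (R - p.1)
  calc _ ≤ ∫⁻ q, C * (stableKernel d α p q * ENNReal.ofReal |freeGenerator d α φ q|) := by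
        refine lintegral_mono fun q => ?_
        rcases le_or_gt q.1 R with h | h
        · rw [← mul_assoc]
          gcongr
          exact hle p q (by linarith)
        · have : freeGenerator d α φ q = 0 := hR q.1 q.2 (h.trans_le (le_abs_self _))
          simp [this]
    _ = C * ∫⁻ q, stableKernel d α p q * ENNReal.ofReal |freeGenerator d α φ q| :=
        lintegral_const_mul' _ _ hC
    _ < ⊤ := ENNReal.mul_lt_top hC.lt_top
        (lintegral_stableTransition_mul_lt_top hd hα hφ hφc p.1 p.2)

lemma stablePotential_freeGenerator_ne_top (hd : 1 ≤ d) (hα : α ∈ Ioo (0 : ℝ) 2)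
    (hφ : ContDiff ℝ ∞ φ) (hφc : HasCompactSupport φ) (p : ℝ × Space d) :
    stablePotential α (fun q => ENNReal.ofReal (freeGenerator d α φ q)) p ≠ ⊤ ∧
    stablePotential α (fun q => ENNReal.ofReal (-freeGenerator d α φ q)) p ≠ ⊤ := by
  have h := lintegral_stableTransition_mul_lt_top hd hα hφ hφc p.1 p.2
  refine ⟨(lt_of_le_of_lt (lintegral_mono fun q => ?_) h).ne,
    (lt_of_le_of_lt (lintegral_mono fun q => ?_) h).ne⟩
  · exact mul_le_mul_right (ENNReal.ofReal_le_ofReal (le_abs_self _)) _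
  · exact mul_le_mul_right (ENNReal.ofReal_le_ofReal (neg_le_abs _)) _

lemma stablePotential_freeGenerator_sub (hd : 1 ≤ d) (hα : α ∈ Ioo (0 : ℝ) 2)
    (hφ : ContDiff ℝ ∞ φ) (hφc : HasCompactSupport φ) (p : ℝ × Space d) :
    (stablePotential α (fun q => ENNReal.ofReal (freeGenerator d α φ q)) p).toReal -
      (stablePotential α (fun q => ENNReal.ofReal (-freeGenerator d α φ q)) p).toReal = -φ p := by
  rw [← integral_stableTransition_mul_freeGenerator hd hα hφ hφc p.1 p.2,
    integral_eq_lintegral_pos_part_sub_lintegral_neg_part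
      (integrable_stableTransition_mul_freeGenerator hd hα hφ hφc p.1 p.2)]
  simp only [← mul_neg, ENNReal.ofReal_mul (stableTransition_nonneg hd hα _ _ _ _)]
  rfl

/-- `P g⁺ + φ⁺ = P g⁻ + φ⁻` for `g = [∂_t + Δ^{α/2}] φ`. -/
lemma stablePotential_add_eq (hd : 1 ≤ d) (hα : α ∈ Ioo (0 : ℝ) 2)
    (hφ : ContDiff ℝ ∞ φ) (hφc : HasCompactSupport φ) (p : ℝ × Space d) :
    stablePotential α (fun q => ENNReal.ofReal (freeGenerator d α φ q)) p + ENNReal.ofReal (φ p)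
      = stablePotential α (fun q => ENNReal.ofReal (-freeGenerator d α φ q)) p +
        ENNReal.ofReal (-φ p) := by
  obtain ⟨h1, h2⟩ := stablePotential_freeGenerator_ne_top hd hα hφ hφc p
  have h := stablePotential_freeGenerator_sub hd hα hφ hφc p
  rw [← ENNReal.toReal_eq_toReal_iff' (by simp [h1]) (by simp [h2]),
    ENNReal.toReal_add h1 (by simp), ENNReal.toReal_add h2 (by simp),
    ENNReal.toReal_ofReal', ENNReal.toReal_ofReal']
  have := max_zero_sub_max_neg_zero_eq_self (φ p)
  linarith

/-- Dominating the test function by potentials lets `J|φ|` be controlled through the perturbation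
equation, with no direct bound on `j`. -/
lemma ofReal_abs_le_stablePotential (hd : 1 ≤ d) (hα : α ∈ Ioo (0 : ℝ) 2)
    (hφ : ContDiff ℝ ∞ φ) (hφc : HasCompactSupport φ) (p : ℝ × Space d) :
    ENNReal.ofReal |φ p| ≤
      stablePotential α (fun q => ENNReal.ofReal (freeGenerator d α φ q)) p +
      stablePotential α (fun q => ENNReal.ofReal (-freeGenerator d α φ q)) p := by
  have h := stablePotential_add_eq hd hα hφ hφc p
  rcases le_total 0 (φ p) with h0 | h0
  · rw [ENNReal.ofReal_of_nonpos (p := -φ p) (by linarith), add_zero] at h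
    rw [abs_of_nonneg h0, ← h]
    exact le_add_self.trans le_add_self
  · rw [ENNReal.ofReal_of_nonpos h0, add_zero] at h
    rw [abs_of_nonpos h0, h]
    exact le_add_self.trans le_self_add

lemma jumpPotential_lt_top (hd : 1 ≤ d) (hα : α ∈ Ioo (0 : ℝ) 2) (hη : 0 ≤ η)
    (hη1 : η < 1) (hc : 0 ≤ c) (hj : Measurable (Function.uncurry j))
    (hsmall : SmallFirstTerm d α j η c) (hφ : ContDiff ℝ ∞ φ) (hφc : HasCompactSupport φ)
    (p : ℝ × Space d) : jumpPotential α j p (fun q => ENNReal.ofReal |φ q|) < ⊤ := by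
  have hg := measurable_freeGenerator hα hφ hφc
  have hfin := lintegral_perturbedKernel_mul_lt_top hd hα hη hη1 hc hj hsmall hφ hφc p
  have key : ∀ h : ℝ × Space d → ℝ≥0∞, Measurable h →
      (∀ q, h q ≤ ENNReal.ofReal |freeGenerator d α φ q|) →
      jumpPotential α j p (stablePotential α h) < ⊤ := by
    intro h hh hle
    refine lt_of_le_of_lt ?_ hfin
    calc _ ≤ stablePotential α h p + jumpPotential α j p (stablePotential α h) := le_add_self
      _ = ∫⁻ q, perturbedKernel d α j p q * h q := (lintegral_perturbedKernel_mul hj p hh).symm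
      _ ≤ _ := lintegral_mono fun q => mul_le_mul_right (hle q) _
  refine (jumpPotential_mono p (ofReal_abs_le_stablePotential hd hα hφ hφc)).trans_lt ?_
  rw [jumpPotential_add hj p (measurable_stablePotential hg.ennreal_ofReal)]
  exact ENNReal.add_lt_top.mpr
    ⟨key _ hg.ennreal_ofReal fun q => ENNReal.ofReal_le_ofReal (le_abs_self _),
      key _ hg.neg.ennreal_ofReal fun q => ENNReal.ofReal_le_ofReal (neg_le_abs _)⟩

lemma ae_jumpInt_lt_top (hd : 1 ≤ d) (hα : α ∈ Ioo (0 : ℝ) 2) (hη : 0 ≤ η)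
    (hη1 : η < 1) (hc : 0 ≤ c) (hj : Measurable (Function.uncurry j))
    (hsmall : SmallFirstTerm d α j η c) (hφ : ContDiff ℝ ∞ φ) (hφc : HasCompactSupport φ) :
    ∀ᵐ q : ℝ × Space d, jumpInt (fun z w => ENNReal.ofReal (j z w))
      (fun q => ENNReal.ofReal |φ q|) q < ⊤ := by
  have hφm : Measurable fun q => ENNReal.ofReal |φ q| :=
    (hφ.continuous.measurable.norm).ennreal_ofReal
  rw [ae_iff]
  refine measure_null_of_locally_null _ fun q _ => ?_
  -- Start one unit of time before `q` at the same place: the increment is then `(1, 0)`, where the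
  -- stable density is positive and continuous.
  set p : ℝ × Space d := (q.1 - 1, q.2) with hp
  set U : Set (ℝ × Space d) := {r | 0 < stableTransition d α p.1 p.2 r.1 r.2} with hU
  have hUn : U ∈ 𝓝 q := by
    have hsub : ContinuousAt (fun r : ℝ × Space d => (r.1 - p.1, r.2 - p.2)) q :=
      Continuous.continuousAt (by fun_prop)
    have hq : (q.1 - p.1, q.2 - p.2) = ((1 : ℝ), (0 : Space d)) := by simp [hp]
    have hcont := continuousAt_stableDensity hd hα.1 one_pos (0 : Space d)
    have h1 : ∀ᶠ r : ℝ × Space d in 𝓝 q, 0 < stableDensity d α (r.1 - p.1) (r.2 - p.2) := by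
      have h2 := hcont.eventually (lt_mem_nhds (stableDensity_zero_pos hd hα.1 one_pos))
      rw [← hq] at h2
      exact hsub.eventually h2
    have h3 : ∀ᶠ r : ℝ × Space d in 𝓝 q, p.1 < r.1 :=
      continuousAt_fst.eventually (lt_mem_nhds (by simp [hp]))
    filter_upwards [h1, h3] with r hr1 hr3
    simpa only [hU, mem_ofPred_eq, stableTransition, if_pos hr3] using hr1
  refine ⟨_, inter_mem self_mem_nhdsWithin (mem_nhdsWithin_of_mem_nhds hUn), ?_⟩
  have hfin := jumpPotential_lt_top hd hα hη hη1 hc hj hsmall hφ hφc p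
  have hae := ae_lt_top ((measurable_perturbedKernel_right hj p).mul
    (measurable_jumpInt (measurable_ofReal_jump hj) hφm)) hfin.ne
  rw [ae_iff] at hae
  refine measure_mono_null (fun r hr => ?_) hae
  obtain ⟨hr1, hr2⟩ := hr
  simp only [mem_ofPred_eq, not_lt, top_le_iff] at hr1 ⊢
  -- As `p̃ ≥ p > 0` on the neighbourhood, an infinite jump integral makes the integrand infinite,
  -- which happens only on a null set.
  have hpos : perturbedKernel d α j p r ≠ 0 := by
    rw [perturbedKernel_eq hj]
    have : 0 < stableKernel d α p r := ENNReal.ofReal_pos.mpr hr2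
    exact (this.trans_le le_self_add).ne'
  simp only [Pi.mul_apply, hr1]
  exact ENNReal.mul_top hpos

lemma ofReal_mul_abs_jump (hj0 : ∀ z w, 0 ≤ j z w) (z w : Space d) (a : ℝ) :
    ‖j z w * a‖ₑ = ENNReal.ofReal (j z w) * ENNReal.ofReal |a| := by
  rw [← ofReal_norm, norm_mul, Real.norm_of_nonneg (hj0 z w), ENNReal.ofReal_mul (hj0 z w)]
  rfl

lemma integrable_jump_mul (hj : Measurable (Function.uncurry j)) (hj0 : ∀ z w, 0 ≤ j z w)
    (hφ : Continuous φ) {q : ℝ × Space d} (hq : jumpInt (fun z w => ENNReal.ofReal (j z w))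
      (fun q => ENNReal.ofReal |φ q|) q < ⊤) :
    Integrable (fun w => j q.2 w * φ (q.1, w)) := by
  refine ⟨(Measurable.mul ?_ ?_).aestronglyMeasurable, ?_⟩
  · exact hj.comp (f := fun w => (q.2, w)) (by fun_prop)
  · exact (hφ.comp (by fun_prop)).measurable
  · rw [hasFiniteIntegral_iff_enorm]
    simp only [ofReal_mul_abs_jump hj0]
    exact hq

lemma measurable_jumpOp (hj : Measurable (Function.uncurry j)) (hφ : Continuous φ) :
    Measurable (fun q : ℝ × Space d => jumpOp j φ q.1 q.2) := by
  unfold jumpOp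
  refine StronglyMeasurable.measurable (StronglyMeasurable.integral_prod_right
    (f := fun (q : ℝ × Space d) (w : Space d) => j q.2 w * φ (q.1, w)) ?_)
  refine Measurable.stronglyMeasurable (Measurable.mul ?_ ?_)
  · exact hj.comp (f := fun a : (ℝ × Space d) × Space d => (a.1.2, a.2)) (by fun_prop)
  · exact (hφ.comp (f := fun a : (ℝ × Space d) × Space d => (a.1.1, a.2)) (by fun_prop)).measurable

lemma jumpOp_eq_sub (hj0 : ∀ z w, 0 ≤ j z w) {q : ℝ × Space d}
    (hq : Integrable (fun w => j q.2 w * φ (q.1, w))) :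
    jumpOp j φ q.1 q.2 =
      (jumpInt (fun z w => ENNReal.ofReal (j z w)) (fun q => ENNReal.ofReal (φ q)) q).toReal -
      (jumpInt (fun z w => ENNReal.ofReal (j z w)) (fun q => ENNReal.ofReal (-φ q)) q).toReal := by
  rw [jumpOp, integral_eq_lintegral_pos_part_sub_lintegral_neg_part hq]
  simp only [← mul_neg, ENNReal.ofReal_mul (hj0 _ _)]
  rfl

lemma integrable_perturbedKernel_mul_jumpOp (hj : Measurable (Function.uncurry j))
    (hj0 : ∀ z w, 0 ≤ j z w) (hφ : Continuous φ) (p : ℝ × Space d)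
    (hfin : jumpPotential α j p (fun q => ENNReal.ofReal |φ q|) < ⊤) :
    Integrable fun q => (perturbedKernel d α j p q).toReal * jumpOp j φ q.1 q.2 := by
  refine ⟨((measurable_perturbedKernel_right hj p).ennreal_toReal.mul
    (measurable_jumpOp hj hφ)).aestronglyMeasurable, ?_⟩
  rw [hasFiniteIntegral_iff_enorm]
  refine lt_of_le_of_lt (lintegral_mono fun q => ?_) hfin
  rw [enorm_mul]
  refine mul_le_mul' ?_ ?_
  · rw [Real.enorm_of_nonneg ENNReal.toReal_nonneg]
    exact ENNReal.ofReal_toReal_le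
  · refine (enorm_integral_le_lintegral_enorm _).trans (le_of_eq ?_)
    simp only [ofReal_mul_abs_jump hj0]
    rfl

lemma integral_perturbedKernel_mul_jumpOp (hj : Measurable (Function.uncurry j))
    (hj0 : ∀ z w, 0 ≤ j z w) (hφ : Continuous φ) (p : ℝ × Space d)
    (hae : ∀ᵐ q : ℝ × Space d, jumpInt (fun z w => ENNReal.ofReal (j z w))
      (fun q => ENNReal.ofReal |φ q|) q < ⊤)
    (hfin : jumpPotential α j p (fun q => ENNReal.ofReal |φ q|) < ⊤) :
    ∫ q, (perturbedKernel d α j p q).toReal * jumpOp j φ q.1 q.2 =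
      (jumpPotential α j p (fun q => ENNReal.ofReal (φ q))).toReal -
      (jumpPotential α j p (fun q => ENNReal.ofReal (-φ q))).toReal := by
  have hφm := hφ.measurable
  have hm : ∀ h : ℝ × Space d → ℝ≥0∞, Measurable h → Measurable fun r =>
      perturbedKernel d α j p r * jumpInt (fun z w => ENNReal.ofReal (j z w)) h r := fun h hh =>
    (measurable_perturbedKernel_right hj p).mul (measurable_jumpInt (measurable_ofReal_jump hj) hh)
  have hf1 : jumpPotential α j p (fun q => ENNReal.ofReal (φ q)) < ⊤ :=
    (jumpPotential_mono p fun r => ENNReal.ofReal_le_ofReal (le_abs_self _)).trans_lt hfin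
  have hf2 : jumpPotential α j p (fun q => ENNReal.ofReal (-φ q)) < ⊤ :=
    (jumpPotential_mono p fun r => ENNReal.ofReal_le_ofReal (neg_le_abs _)).trans_lt hfin
  have hm1 := hm _ hφm.ennreal_ofReal
  have hm2 := hm (fun q => ENNReal.ofReal (-φ q)) hφm.neg.ennreal_ofReal
  have e1 := integral_toReal hm1.aemeasurable (ae_lt_top hm1 hf1.ne)
  have e2 := integral_toReal hm2.aemeasurable (ae_lt_top hm2 hf2.ne)
  unfold jumpPotential
  rw [← e1, ← e2, ← integral_sub (integrable_toReal_of_lintegral_ne_top hm1.aemeasurable hf1.ne)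
    (integrable_toReal_of_lintegral_ne_top hm2.aemeasurable hf2.ne)]
  refine integral_congr_ae ?_
  filter_upwards [hae] with q hq
  rw [jumpOp_eq_sub hj0 (integrable_jump_mul hj hj0 hφ hq), ENNReal.toReal_mul, ENNReal.toReal_mul]
  ring

lemma integrable_perturbedKernel_mul_freeGenerator (hα : α ∈ Ioo (0 : ℝ) 2)
    (hj : Measurable (Function.uncurry j)) (hφ : ContDiff ℝ ∞ φ) (hφc : HasCompactSupport φ)
    (p : ℝ × Space d)
    (hfin : ∫⁻ q, perturbedKernel d α j p q * ENNReal.ofReal |freeGenerator d α φ q| < ⊤) :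
    Integrable fun q => (perturbedKernel d α j p q).toReal * freeGenerator d α φ q := by
  refine ⟨((measurable_perturbedKernel_right hj p).ennreal_toReal.mul
    (measurable_freeGenerator hα hφ hφc)).aestronglyMeasurable, ?_⟩
  rw [hasFiniteIntegral_iff_enorm]
  refine lt_of_le_of_lt (lintegral_mono fun q => ?_) hfin
  rw [enorm_mul]
  refine mul_le_mul' ?_ (Real.enorm_eq_ofReal_abs _).le
  rw [Real.enorm_of_nonneg ENNReal.toReal_nonneg]
  exact ENNReal.ofReal_toReal_le

lemma integral_perturbedKernel_mul_freeGenerator (hα : α ∈ Ioo (0 : ℝ) 2)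
    (hj : Measurable (Function.uncurry j)) (hφ : ContDiff ℝ ∞ φ) (hφc : HasCompactSupport φ)
    (p : ℝ × Space d) (htop : ∀ q, perturbedKernel d α j p q ≠ ⊤)
    (hfin : ∫⁻ q, perturbedKernel d α j p q * ENNReal.ofReal |freeGenerator d α φ q| < ⊤) :
    ∫ q, (perturbedKernel d α j p q).toReal * freeGenerator d α φ q =
      (∫⁻ q, perturbedKernel d α j p q * ENNReal.ofReal (freeGenerator d α φ q)).toReal -
      (∫⁻ q, perturbedKernel d α j p q * ENNReal.ofReal (-freeGenerator d α φ q)).toReal := by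
  rw [integral_eq_lintegral_pos_part_sub_lintegral_neg_part
    (integrable_perturbedKernel_mul_freeGenerator hα hj hφ hφc p hfin)]
  simp only [← mul_neg, ENNReal.ofReal_mul ENNReal.toReal_nonneg, ENNReal.ofReal_toReal (htop _)]

lemma perturbedKernel_fundamental (hd : 1 ≤ d) (hα : α ∈ Ioo (0 : ℝ) 2) (hη : 0 ≤ η)
    (hη1 : η < 1) (hc : 0 ≤ c) (hj : Measurable (Function.uncurry j)) (hj0 : ∀ z w, 0 ≤ j z w)
    (hsmall : SmallFirstTerm d α j η c) (hφ : ContDiff ℝ ∞ φ) (hφc : HasCompactSupport φ)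
    (p : ℝ × Space d) :
    Integrable (fun q => (perturbedKernel d α j p q).toReal *
      perturbedGenerator d α j φ q.1 q.2) ∧
    ∫ q, (perturbedKernel d α j p q).toReal * perturbedGenerator d α j φ q.1 q.2 = -φ p := by
  have hsplit : (fun q => (perturbedKernel d α j p q).toReal * perturbedGenerator d α j φ q.1 q.2)
      = fun q => (perturbedKernel d α j p q).toReal * freeGenerator d α φ q +
        (perturbedKernel d α j p q).toReal * jumpOp j φ q.1 q.2 := by
    funext q
    rw [← mul_add]
    rfl
  have hfinA := lintegral_perturbedKernel_mul_lt_top hd hα hη hη1 hc hj hsmall hφ hφc p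
  have hfinB := jumpPotential_lt_top hd hα hη hη1 hc hj hsmall hφ hφc p
  have hae := ae_jumpInt_lt_top hd hα hη hη1 hc hj hsmall hφ hφc
  have i1 := integrable_perturbedKernel_mul_freeGenerator hα hj hφ hφc p hfinA
  have i2 := integrable_perturbedKernel_mul_jumpOp hj hj0 hφ.continuous p hfinB
  rw [hsplit]
  refine ⟨i1.add i2, ?_⟩
  rw [integral_add i1 i2, integral_perturbedKernel_mul_freeGenerator hα hj hφ hφc p
    (perturbedKernel_ne_top hη hη1 hc hj hsmall p) hfinA,
    integral_perturbedKernel_mul_jumpOp hj hj0 hφ.continuous p hae hfinB]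
  have hg := measurable_freeGenerator hα hφ hφc
  have hφm := hφ.continuous.measurable
  set G₁ : ℝ × Space d → ℝ≥0∞ := fun q => ENNReal.ofReal (freeGenerator d α φ q) with hG₁
  set G₂ : ℝ × Space d → ℝ≥0∞ := fun q => ENNReal.ofReal (-freeGenerator d α φ q) with hG₂
  have hm1 : Measurable G₁ := hg.ennreal_ofReal
  have hm2 : Measurable G₂ := hg.neg.ennreal_ofReal
  have a1 := lintegral_perturbedKernel_mul (α := α) hj p hm1
  have a2 := lintegral_perturbedKernel_mul (α := α) hj p hm2
  have f1 : stablePotential α G₁ p + jumpPotential α j p (stablePotential α G₁) < ⊤ := by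
    rw [← a1]
    exact (lintegral_mono fun q =>
      mul_le_mul_right (ENNReal.ofReal_le_ofReal (le_abs_self _)) _).trans_lt hfinA
  have f2 : stablePotential α G₂ p + jumpPotential α j p (stablePotential α G₂) < ⊤ := by
    rw [← a2]
    exact (lintegral_mono fun q =>
      mul_le_mul_right (ENNReal.ofReal_le_ofReal (neg_le_abs _)) _).trans_lt hfinA
  obtain ⟨f1p, f1b⟩ := ENNReal.add_lt_top.mp f1
  obtain ⟨f2p, f2b⟩ := ENNReal.add_lt_top.mp f2
  have g1 : jumpPotential α j p (fun q => ENNReal.ofReal (φ q)) < ⊤ :=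
    (jumpPotential_mono p fun r => ENNReal.ofReal_le_ofReal (le_abs_self _)).trans_lt hfinB
  have g2 : jumpPotential α j p (fun q => ENNReal.ofReal (-φ q)) < ⊤ :=
    (jumpPotential_mono p fun r => ENNReal.ofReal_le_ofReal (neg_le_abs _)).trans_lt hfinB
  -- Apply `P̃ J` to the pointwise balance `P g⁺ + φ⁺ = P g⁻ + φ⁻`. All four terms are finite, so
  -- after passing to reals `P̃ J P g⁺ - P̃ J P g⁻` cancels the integral of `p̃ Jφ`, and `P g⁺ - P
  -- g⁻ = -φ` remains.
  have hbal : jumpPotential α j p (stablePotential α G₁) +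
      jumpPotential α j p (fun q => ENNReal.ofReal (φ q)) =
      jumpPotential α j p (stablePotential α G₂) +
      jumpPotential α j p (fun q => ENNReal.ofReal (-φ q)) := by
    rw [← jumpPotential_add hj p (measurable_stablePotential hm1),
      ← jumpPotential_add hj p (measurable_stablePotential hm2)]
    congr 1
    funext r
    exact stablePotential_add_eq hd hα hφ hφc r
  have hbal' := congrArg ENNReal.toReal hbal
  rw [ENNReal.toReal_add f1b.ne g1.ne, ENNReal.toReal_add f2b.ne g2.ne] at hbal'
  have hfree := stablePotential_freeGenerator_sub hd hα hφ hφc p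
  rw [a1, a2, ENNReal.toReal_add f1p.ne f1b.ne, ENNReal.toReal_add f2p.ne f2b.ne]
  simp only [← hG₁, ← hG₂] at hfree
  linarith

end Perturbation

end NonlocalPerturbation

theorem mainTheorem8 (d : ℕ) (hd : 1 ≤ d) (α : ℝ) (hα : α ∈ Set.Ioo (0 : ℝ) 2)
    (j : NonlocalPerturbation.Space d → NonlocalPerturbation.Space d → ℝ)
    (hj_meas : Measurable (Function.uncurry j)) (hj_nonneg : ∀ z w, 0 ≤ j z w)
    (η c : ℝ) (hη0 : 0 ≤ η) (hη1 : η < 1) (hc : 0 ≤ c)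
    (hsmall : NonlocalPerturbation.SmallFirstTerm d α j η c) :
    (∀ (s : ℝ) (x : NonlocalPerturbation.Space d) (t : ℝ) (y : NonlocalPerturbation.Space d),
      NonlocalPerturbation.perturbedStable d α j s x t y ≠ ⊤) ∧
    ∀ φ : ℝ × NonlocalPerturbation.Space d → ℝ, ContDiff ℝ ∞ φ → HasCompactSupport φ →
      (∀ᵐ q : ℝ × NonlocalPerturbation.Space d, Integrable (fun w => j q.2 w * φ (q.1, w))) ∧
      ∀ (s : ℝ) (x : NonlocalPerturbation.Space d),
        Integrable (fun q : ℝ × NonlocalPerturbation.Space d =>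
          (NonlocalPerturbation.perturbedStable d α j s x q.1 q.2).toReal *
            NonlocalPerturbation.perturbedGenerator d α j φ q.1 q.2) ∧
        ∫ t : ℝ, ∫ y : NonlocalPerturbation.Space d,
          (NonlocalPerturbation.perturbedStable d α j s x t y).toReal *
            NonlocalPerturbation.perturbedGenerator d α j φ t y = -φ (s, x) := by
  refine ⟨fun s x t y => NonlocalPerturbation.perturbedKernel_ne_top hη0 hη1 hc hj_meas hsmall (s, x) (t, y),
    fun φ hφ hφc => ⟨?_, fun s x => ?_⟩⟩
  · filter_upwards [NonlocalPerturbation.ae_jumpInt_lt_top hd hα hη0 hη1 hc hj_meas hsmall hφ hφc]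
      with q hq
    exact NonlocalPerturbation.integrable_jump_mul hj_meas hj_nonneg hφ.continuous hq
  · obtain ⟨hint, heq⟩ := NonlocalPerturbation.perturbedKernel_fundamental hd hα hη0 hη1 hc hj_meas
      hj_nonneg hsmall hφ hφc (s, x)
    refine ⟨hint, ?_⟩
    rw [← heq, MeasureTheory.Measure.volume_eq_prod, MeasureTheory.integral_prod _ hint]
    rfl
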